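/- Throughout $\mathbb{N}=\{1,2,\dots\}$. For $m\in\mathbb{N}$ and a prime $p$ let $m_p$ be the greatest power of $p$ dividing $m$, let $\pi(m)$ be the set of primes dividing $m$, and for a set $\pi$ of primes let $m_\pi=\prod_{p\in\pi}m_p$; $2'$ is the set of odd primes. Let $\mathcal U_m$ be the group of units of $\mathbb{Z}/m\mathbb{Z}$ and, for $q\mid m$, let $\mathrm{Res}_q:\mathcal U_m\to\mathcal U_q$ be the natural map. For a cyclic subgroup $T$ of $\mathcal U_m$ put $[T]=(r,\epsilon,o)$, where $r$ is the greatest divisor of $m$ such that $\mathrm{Res}_{r_{2'}}(T)=1$ and $\mathrm{Res}_{r_2}(T)\subseteq\langle -1\rangle$; $\epsilon=-1$ if $\mathrm{Res}_{r_2}(T)\neq 1$ and $\epsilon=1$ otherwise; and $o=|\mathrm{Res}_{m_\nu}(T_{\nu'})|$, where $\nu=\pi(m)\setminus\pi(r)$ and $T_{\nu'}$ is the Hall $\nu'$-subgroup of $T$. For $n,s\in\mathbb{N}$ put $$[T,n,s]=m_\nu\prod_{p\in\pi(r)}m'_p ,$$ where, if $\epsilon^{p-1}=1$, $$m'_p=\min\Bigl(m_p,\;o_pr_p,\;\max\bigl(r_p,\;s_p,\;r_p\tfrac{s_po_p}{n_p}\bigr)\Bigr),$$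 and, if $\epsilon=-1$, $$m'_2=\begin{cases} r_2, & \text{if } o_2\le 2 \text{ or } m_2\le 2r_2;\\ \tfrac{m_2}{2}, & \text{else if } 4\le o_2<n_2,\ 4r_2\le m \text{ and } \bigl(s_2\le n_2r_2\Rightarrow 2s_2=m_2<n_2r_2\bigr);\\ m_2, & \text{otherwise.}\end{cases}$$ Let $G$ be a finite group. A metacyclic factorization $G=AB$ consists of a cyclic normal subgroup $A$ of $G$ and a cyclic subgroup $B$ of $G$ with $G=AB$; $G$ is metacyclic if it has a cyclic normal subgroup with cyclic quotient. For a metacyclic factorization $G=AB$ let $T_G(A)\le\mathcal U_{|A|}$ be the group of those classes $[k]$ for which $a\mapsto a^k$ is the restriction to $A$ of an inner automorphism of $G$, and let $r_G(A)$ be the first entry of $[T_G(A)]$. The factorization $G=AB$ is minimal if $(|A|,r_G(A),[G:B])$ is minimal in the lexicographical order among all metacyclic factorizations of $G$. Let $$\Delta(AB)=\mathrm{Res}_{[T,n,s]}(T),\qquad T=T_G(A),\quad n=[G:A],\quad s=[G:B],$$ a subgroup of $\mathcal U_{[T,n,s]}$. **Statement.** Let $G$ be a finite group. If $G=AB=CD$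 are two minimal metacyclic factorizations of $G$, then $\Delta(AB)=\Delta(CD)$ (that is, the moduli are equal and the subgroups of the group of units modulo this number are equal). Hence the fourth entry of $\mathrm{MCINV}(G)=(|A|,[G:A],[G:B],\Delta(AB))$, with $G=AB$ a minimal metacyclic factorization, is well defined: if $G$ is metacyclic, there is exactly one $\Delta$ such that $\Delta=\Delta(AB)$ for some minimal metacyclic factorization $G=AB$. -/

import Mathlib

/-- A group is metacyclic if it has a cyclic normal subgroup with cyclic quotient. -/
def IsMetacyclic (G : Type*) [Group G] : Prop :=
  ∃ (A : Subgroup G) (_ : A.Normal), IsCyclic A ∧ IsCyclic (G ⧸ A)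

/-- A metacyclic factorization `G = AB`: `A` is a cyclic normal subgroup of `G` and `B` is a cyclic
subgroup of `G`. -/
structure MetacyclicFactorization (G : Type*) [Group G] where
  A : Subgroup G
  B : Subgroup G
  normal : A.Normal
  cyclic_left : IsCyclic A
  cyclic_right : IsCyclic B
  mul_eq : ∀ g : G, ∃ a ∈ A, ∃ b ∈ B, a * b = g

namespace Metacyclic

/-- `m_p`, the largest power of `p` dividing `m`. -/
def part (p m : ℕ) : ℕ := p ^ m.factorization p

/-- `π(m) \ π(r)`. -/
def nuSet (m r : ℕ) : Finset ℕ := m.primeFactors \ r.primeFactors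

/-- `m_π = ∏_{p ∈ π} m_p`. -/
def piPart (π : Finset ℕ) (m : ℕ) : ℕ := ∏ p ∈ π, part p m

open Classical in
/-- `Res_q(T)`, the image of `T ≤ (ℤ/m)ˣ` under the natural map `(ℤ/m)ˣ → (ℤ/q)ˣ`.
It is only used when `q ∣ m`; the other value is a default. -/
noncomputable def res {m : ℕ} (q : ℕ) (T : Subgroup (ZMod m)ˣ) : Subgroup (ZMod q)ˣ :=
  if h : q ∣ m then T.map (ZMod.unitsMap h) else ⊥

open Classical in
/-- The entry `r`: the greatest divisor `d` of `m` such that `Res_{d_{2'}}(T) = 1` and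
`Res_{d_2}(T) ⊆ ⟨-1⟩`. -/
noncomputable def invR {m : ℕ} (T : Subgroup (ZMod m)ˣ) : ℕ :=
  (m.divisors.filter fun d =>
    res (d / part 2 d) T = ⊥ ∧ res (part 2 d) T ≤ Subgroup.zpowers (-1)).sup id

open Classical in
/-- The entry `ε`. -/
noncomputable def invEps {m : ℕ} (T : Subgroup (ZMod m)ˣ) : ℤ :=
  if res (part 2 (invR T)) T ≠ ⊥ then -1 else 1

/-- The Hall `ν'`-subgroup of a subgroup `T` of a (finite) commutative group: the elements of `T`
whose order is not divisible by any prime of `ν`. -/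
def hallCompl {U : Type*} [CommGroup U] (ν : Finset ℕ) (T : Subgroup U) : Subgroup U where
  carrier := {x | x ∈ T ∧ (orderOf x).Coprime (∏ p ∈ ν, p)}
  one_mem' := ⟨T.one_mem, by simp⟩
  mul_mem' := fun {x y} hx hy => ⟨T.mul_mem hx.1 hy.1,
    Nat.Coprime.coprime_dvd_left
      (((Commute.all x y).orderOf_mul_dvd_lcm).trans (Nat.lcm_dvd_mul _ _))
      (Nat.Coprime.mul_left hx.2 hy.2)⟩
  inv_mem' := fun {x} hx => ⟨T.inv_mem hx.1, by rw [orderOf_inv]; exact hx.2⟩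

/-- The entry `o = |Res_{m_ν}(T_{ν'})|`, where `ν = π(m) \ π(r)`. -/
noncomputable def invO {m : ℕ} (T : Subgroup (ZMod m)ˣ) : ℕ :=
  Nat.card (res (piPart (nuSet m (invR T)) m) (hallCompl (nuSet m (invR T)) T))

open Classical in
/-- The number `m'_p` for `p ∈ π(r)`. The truncated quotient below agrees with the exact
one: all numbers involved are powers of `p`, so the quotient is either exact or smaller than `1`,
and in the latter case the maximum ignores it since `r_p ≥ 1`. -/
noncomputable def mPrimeAt {m : ℕ} (T : Subgroup (ZMod m)ˣ) (n s p : ℕ) : ℕ :=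
  let mp := part p m
  let np := part p n
  let sp := part p s
  let rp := part p (invR T)
  let op := part p (invO T)
  if invEps T ^ (p - 1) = 1 then
    min mp (min (op * rp) (max rp (max sp (rp * sp * op / np))))
  else if op ≤ 2 ∨ mp ≤ 2 * rp then rp
  else if 4 ≤ op ∧ op < np ∧ 4 * rp ≤ m ∧ (sp ≤ np * rp → 2 * sp = mp ∧ mp < np * rp) then mp / 2
  else mp

/-- `[T, n, s] = m_ν ∏_{p ∈ π(r)} m'_p`. -/
noncomputable def mPrime {m : ℕ} (T : Subgroup (ZMod m)ˣ) (n s : ℕ) : ℕ :=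
  piPart (nuSet m (invR T)) m * ∏ p ∈ (invR T).primeFactors, mPrimeAt T n s p

lemma res_one_div_part {m : ℕ} (T : Subgroup (ZMod m)ˣ) :
    res (1 / part 2 1) T = ⊥ ∧ res (part 2 1) T ≤ Subgroup.zpowers (-1) := by
  have e : part 2 1 = 1 := by simp [part]
  have e' : 1 / part 2 1 = 1 := by simp [part]
  rw [e', e]
  exact ⟨Subsingleton.elim _ _, fun x _ => by
    rw [Subsingleton.elim x 1]; exact Subgroup.one_mem _⟩

lemma invR_dvd {m : ℕ} (hm : m ≠ 0) (T : Subgroup (ZMod m)ˣ) : invR T ∣ m := by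
  classical
  have h1 : (1 : ℕ) ∈ (m.divisors.filter fun d =>
      res (d / part 2 d) T = ⊥ ∧ res (part 2 d) T ≤ Subgroup.zpowers (-1)) :=
    Finset.mem_filter.2 ⟨by simp [hm], res_one_div_part T⟩
  obtain ⟨d, hd, e⟩ := Finset.exists_mem_eq_sup _ ⟨1, h1⟩ (id : ℕ → ℕ)
  have : invR T = d := by
    unfold invR
    refine Eq.trans ?_ e
    congr
  rw [this]
  exact Nat.dvd_of_mem_divisors (Finset.mem_filter.1 hd).1

lemma mPrimeAt_dvd {m : ℕ} (hm : m ≠ 0) (T : Subgroup (ZMod m)ˣ) (n s p : ℕ) (hp : p.Prime) :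
    mPrimeAt T n s p ∣ part p m := by
  have hpow : ∀ k : ℕ, ∃ i, part p k = p ^ i := fun k => ⟨_, rfl⟩
  have hdvd : part p (invR T) ∣ part p m :=
    pow_dvd_pow _ ((Nat.factorization_le_iff_dvd
      (fun h => hm (Nat.eq_zero_of_zero_dvd (h ▸ invR_dvd hm T))) hm).2 (invR_dvd hm T) p)
  have hmax : ∀ i j : ℕ, ∃ k, max (p ^ i) (p ^ j) = p ^ k := fun i j => by
    rcases le_total (p ^ i) (p ^ j) with h | h
    · exact ⟨j, max_eq_right h⟩
    · exact ⟨i, max_eq_left h⟩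
  have hmin : ∀ i j : ℕ, ∃ k, min (p ^ i) (p ^ j) = p ^ k := fun i j => by
    rcases le_total (p ^ i) (p ^ j) with h | h
    · exact ⟨i, min_eq_left h⟩
    · exact ⟨j, min_eq_right h⟩
  unfold mPrimeAt
  simp only []
  obtain ⟨a, ha⟩ := hpow m
  obtain ⟨b, hb⟩ := hpow n
  obtain ⟨c, hc⟩ := hpow s
  obtain ⟨d, hd⟩ := hpow (invR T)
  obtain ⟨e, he⟩ := hpow (invO T)
  rw [hd, ha] at hdvd
  rw [ha, hb, hc, hd, he]
  split_ifs with h1 h2 h3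
  · have hq : p ^ d * p ^ c * p ^ e / p ^ b = 0 ∨
        ∃ k, p ^ d * p ^ c * p ^ e / p ^ b = p ^ k := by
      rw [← pow_add, ← pow_add]
      rcases le_or_gt b (d + c + e) with h | h
      · exact Or.inr ⟨_, Nat.pow_div h hp.pos⟩
      · exact Or.inl (Nat.div_eq_of_lt (Nat.pow_lt_pow_right hp.one_lt h))
    have hk : ∃ k, max (p ^ d) (max (p ^ c) (p ^ d * p ^ c * p ^ e / p ^ b)) = p ^ k := by
      rcases hq with h | ⟨k, h⟩
      · rw [h, Nat.max_zero]
        exact hmax _ _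
      · rw [h]
        obtain ⟨j, hj⟩ := hmax c k
        rw [hj]
        exact hmax _ _
    obtain ⟨k, hk⟩ := hk
    obtain ⟨l, hl⟩ := hmin (e + d) k
    rw [hk, ← pow_add, hl]
    rcases le_total a l with h | h
    · rw [min_eq_left (Nat.pow_le_pow_right hp.pos h)]
    · rw [min_eq_right (Nat.pow_le_pow_right hp.pos h)]
      exact pow_dvd_pow _ h
  · exact hdvd
  · have h2' : 1 < p ^ a := by
      have : 0 < p ^ d := Nat.pow_pos hp.pos
      omega
    have ha0 : a ≠ 0 := by
      rintro rfl
      simp at h2'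
    have hp2 : p = 2 := by
      by_contra hne
      apply h1
      have hev : Even (p - 1) := hp.even_sub_one hne
      unfold invEps
      split_ifs
      · exact hev.neg_one_pow
      · exact one_pow _
    exact Nat.div_dvd_of_dvd (hp2 ▸ dvd_pow_self p ha0)
  · exact dvd_rfl

/-- `[T, n, s]` divides `m`. -/
lemma mPrime_dvd {m : ℕ} (hm : m ≠ 0) (T : Subgroup (ZMod m)ˣ) (n s : ℕ) : mPrime T n s ∣ m := by
  have hsub : (invR T).primeFactors ⊆ m.primeFactors := Nat.primeFactors_mono (invR_dvd hm T) hm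
  have h : mPrime T n s ∣
      piPart (nuSet m (invR T)) m * ∏ p ∈ (invR T).primeFactors, part p m :=
    mul_dvd_mul_left _ (Finset.prod_dvd_prod_of_dvd _ _ fun p hp =>
      mPrimeAt_dvd hm T n s p (Nat.prime_of_mem_primeFactors hp))
  have h' : piPart (nuSet m (invR T)) m * ∏ p ∈ (invR T).primeFactors, part p m = m := by
    unfold piPart nuSet
    rw [Finset.prod_sdiff hsub]
    exact Nat.prod_factorization_pow_eq_self hm
  rwa [h'] at h

end Metacyclic

/-- `T_G(A)`, the preimage of `Inn_G(A)` under `σ_A : (ℤ/|A|)ˣ → Aut(A)`, `[k] ↦ (a ↦ a ^ k)`. -/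
def Subgroup.conjUnits {G : Type*} [Group G] (A : Subgroup G) : Subgroup (ZMod (Nat.card A))ˣ where
  carrier := {u | ∃ (g : G) (k : ℤ), (k : ZMod (Nat.card A)) = u ∧
    ∀ a ∈ A, g⁻¹ * a * g = a ^ k}
  one_mem' := ⟨1, 1, by simp, fun a _ => by simp⟩
  mul_mem' := by
    rintro u v ⟨g, k, hk, hg⟩ ⟨h, l, hl, hh⟩
    refine ⟨g * h, k * l, by push_cast; rw [hk, hl], fun a ha => ?_⟩
    have e : (g * h)⁻¹ * a * (g * h) = h⁻¹ * (g⁻¹ * a * g) * h := by group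
    rw [e, hg a ha, hh _ (A.zpow_mem ha k), zpow_mul]
  inv_mem' := by
    rintro u ⟨g, k, hk, hg⟩
    obtain ⟨l, hl⟩ := ZMod.intCast_surjective ((u⁻¹ : (ZMod (Nat.card A))ˣ) : ZMod (Nat.card A))
    refine ⟨g⁻¹, l, hl, fun a ha => ?_⟩
    have h1 : ((l * k : ℤ) : ZMod (Nat.card A)) = ((1 : ℤ) : ZMod (Nat.card A)) := by
      push_cast
      rw [hk, hl, Units.inv_mul]
    have h2 : a ^ (l * k) = a := by
      obtain ⟨c, hc⟩ := (ZMod.intCast_eq_intCast_iff_dvd_sub _ _ _).1 h1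
      have h3 : a ^ (Nat.card A) = 1 := by
        have h6 := pow_card_eq_one' (x := (⟨a, ha⟩ : A))
        exact congrArg (Subtype.val : A → G) h6
      have h4 : l * k = 1 - (Nat.card A : ℤ) * c := by linarith
      rw [h4, zpow_sub, zpow_mul, zpow_natCast, h3]
      simp
    have h5 := hg _ (A.zpow_mem ha l)
    rw [← zpow_mul, h2] at h5
    have h7 : g⁻¹⁻¹ * (g⁻¹ * a ^ l * g) * g⁻¹ = a ^ l := by group
    rwa [h5] at h7

namespace MetacyclicFactorization

variable {G : Type*} [Group G]

/-- `r_G(A)`. -/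
noncomputable def r (F : MetacyclicFactorization G) : ℕ := Metacyclic.invR F.A.conjUnits

/-- The triple `(|A|, r_G(A), [G : B])`, in the lexicographical order. -/
noncomputable def key (F : MetacyclicFactorization G) : ℕ ×ₗ ℕ ×ₗ ℕ :=
  toLex (Nat.card F.A, toLex (F.r, F.B.index))

/-- A metacyclic factorization `G = AB` is minimal if `(|A|, r_G(A), [G : B])` is minimal, in the
lexicographical order, among all metacyclic factorizations of `G`. -/
def IsMinimal (F : MetacyclicFactorization G) : Prop :=
  ∀ F' : MetacyclicFactorization G, F.key ≤ F'.key

/-- The modulus `m' = [T, n, s]` with `T = T_G(A)`, `n = [G : A]` and `s = [G : B]`. -/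
noncomputable def modulus (F : MetacyclicFactorization G) : ℕ :=
  Metacyclic.mPrime F.A.conjUnits F.A.index F.B.index

lemma modulus_dvd [Finite G] (F : MetacyclicFactorization G) : F.modulus ∣ Nat.card F.A :=
  Metacyclic.mPrime_dvd Nat.card_pos.ne' _ _ _

/-- `Δ(AB) = Res_{m'}(T_G(A))`, as a pair: the modulus `m' = [T, n, s]` together with a subgroup of
the group of units modulo `m'`. -/
noncomputable def delta [Finite G] (F : MetacyclicFactorization G) :
    Σ k : ℕ, Subgroup (ZMod k)ˣ :=
  ⟨F.modulus, F.A.conjUnits.map (ZMod.unitsMap F.modulus_dvd)⟩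

end MetacyclicFactorization

/-! Write the two factorizations as `⟨a⟩⟨b⟩` and `⟨c⟩⟨d⟩`, with `b` acting on `a` by the exponent
`t`, `d` acting on `c` by `t'`, and `d = a ^ l * b ^ k`. Put `m = |A|`, `n = [G : A]`, `s = [G :
B]`, and let `Q = m_ν` be the part of `m` prime to `r`. Minimality makes `m`, `r`, `s` common to
both, hence also `n`. Since `T` is generated by the class of `t`, it suffices to find an exponent
`i` with `t ^ i ≡ t'` modulo `m' = [T, n, s]`; exchanging the factorizations gives the other
inclusion.

The basic fact is that `a ^ (t - 1)` is a commutator and therefore lies in `⟨c⟩` too. An element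
acting by `w` on `a` and by `y` on `c` acts on it in both ways, so `m ∣ (t - 1)(w - y)`
(`MetacyclicGen.agree`). As `t - 1` is a unit modulo `Q`, this gives `t ^ k ≡ t'` modulo `Q`; from
this `o` and `ε` are seen to be common as well.

At a prime `p ∣ r` the `p`-part of `c` is written as `α ^ u * b ^ V`, with `α` the `p`-part of `a`
and `b ^ V` centralizing the `p'`-part of `⟨a⟩`. Conjugating by `d` gives one congruence modulo
`m_p` relating `u`, `V`, `l`, `k`, `t`, `t'` (`exists_exponents`). Here `o ∣ V`, so `t ^ V` is close
to `1`, and `u` is prime to `p` whenever more than the congruence modulo `r_p` is wanted. What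
remains is `u (t ^ k - t') ≡ s k₀ f` with `n f = V (t' - 1)`, and the terms of the maximum defining
`m'_p` are conditions under which `s f` vanishes (`pow_dvd_sub_of_trivial`).

If `p = 2` and `ε = -1`, then `t - 1` is exactly once even, so `agree` already gives `t ^ k ≡ t'`
modulo `m_2 / 2`; the last factor of two is a parity computation (`two_pow_dvd_sub_of_neg`). It uses
exact 2-adic valuations and the minimality of `[G : B]`, which excludes `s_2 = m_2 = n_2 r_2`. If
only the congruence modulo `r_2` is needed, every odd exponent serves there, and an even `k` can be
corrected to an odd one without disturbing the other primes (`exists_pow_dvd`). -/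

/-- `G = ⟨a⟩⟨b⟩` with `b * a * b⁻¹ = a ^ t`. -/
structure MetacyclicGen {G : Type*} [Group G] (a b : G) (t : ℕ) : Prop where
  conj : b * a * b⁻¹ = a ^ t
  span : ∀ g : G, ∃ i j : ℕ, g = a ^ i * b ^ j

/-! ### Commutators, actions and indices in one or two presentations. -/

namespace MetacyclicGen

variable {G : Type*} [Group G] {a b c d : G} {t t' : ℕ}

lemma pow_conj (h : MetacyclicGen a b t) (k : ℕ) : b ^ k * a * (b ^ k)⁻¹ = a ^ (t ^ k) := by
  induction k with
  | zero => simp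
  | succ k ih =>
    have e : b ^ (k + 1) * a * (b ^ (k + 1))⁻¹ = b ^ k * (b * a * b⁻¹) * (b ^ k)⁻¹ := by
      rw [pow_succ]; group
    rw [e, h.conj, ← conj_pow, ih, ← pow_mul, pow_succ]

lemma conj_eq (h : MetacyclicGen a b t) {g : G} {l k : ℕ} (hg : g = a ^ l * b ^ k) :
    g * a * g⁻¹ = a ^ (t ^ k) := by
  have e : g * a * g⁻¹ = a ^ l * (b ^ k * a * (b ^ k)⁻¹) * (a ^ l)⁻¹ := by
    rw [hg]; group
  rw [e, h.pow_conj, (Commute.pow_pow_self a l (t ^ k)).eq, mul_inv_cancel_right]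

lemma conj_zpow_mem (h : MetacyclicGen a b t) (g : G) (i : ℤ) :
    ∃ j : ℕ, g * a ^ i * g⁻¹ = (a ^ i) ^ j := by
  obtain ⟨l, k, hg⟩ := h.span g
  exact ⟨t ^ k, by rw [← conj_zpow, h.conj_eq hg, ← zpow_natCast, ← zpow_natCast, ← zpow_mul,
    ← zpow_mul, mul_comm]⟩

lemma normal (h : MetacyclicGen a b t) (i : ℤ) : (Subgroup.zpowers (a ^ i)).Normal := by
  refine ⟨fun x hx g => ?_⟩
  obtain ⟨j, rfl⟩ := Subgroup.mem_zpowers_iff.1 hx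
  obtain ⟨k, hk⟩ := h.conj_zpow_mem g i
  rw [← conj_zpow, hk]
  exact Subgroup.zpow_mem _ (Subgroup.pow_mem _ (Subgroup.mem_zpowers _) _) _

/-- Modulo `a ^ i` the commutator `a ^ (t - 1)` of the two generators dies. -/
lemma commute_quotient (h : MetacyclicGen a b t) {i : ℤ} (hi : i ∣ (t : ℤ) - 1)
    (N : Subgroup G) [N.Normal] (hN : a ^ i ∈ N) (x y : G) :
    Commute (x : G ⧸ N) (y : G ⧸ N) := by
  have hab : Commute (a : G ⧸ N) (b : G ⧸ N) := by
    obtain ⟨j, hj⟩ := hi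
    have e : b * a * b⁻¹ = (a ^ i) ^ j * a := by
      rw [h.conj, ← zpow_mul, ← hj, ← zpow_natCast, zpow_sub_one, inv_mul_cancel_right]
    have e' : b * a = (a ^ i) ^ j * a * b := by rw [← e]; group
    have e2 := congrArg (QuotientGroup.mk (s := N)) e'
    simp only [QuotientGroup.mk_mul, QuotientGroup.mk_zpow N (a ^ i) j] at e2
    rw [(QuotientGroup.eq_one_iff (N := N) (a ^ i)).2 hN] at e2
    simp only [one_zpow, one_mul] at e2
    exact e2.symm
  obtain ⟨i₁, j₁, rfl⟩ := h.span x
  obtain ⟨i₂, j₂, rfl⟩ := h.span y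
  simp only [QuotientGroup.mk_mul, QuotientGroup.mk_pow]
  exact ((Commute.pow_pow_self _ _ _).mul_right (hab.pow_pow _ _)).mul_left
    ((hab.symm.pow_pow _ _).mul_right (Commute.pow_pow_self _ _ _))

lemma commutator_mem (h : MetacyclicGen a b t) {i : ℤ} (hi : i ∣ (t : ℤ) - 1) (x y : G) :
    x * y * x⁻¹ * y⁻¹ ∈ Subgroup.zpowers (a ^ i) := by
  have := h.normal i
  rw [← QuotientGroup.eq_one_iff]
  have := h.commute_quotient hi _ (Subgroup.mem_zpowers (a ^ i)) x y
  simp only [QuotientGroup.mk_mul, QuotientGroup.mk_inv]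
  rw [this.eq]
  group

/-- The left side is the commutator of `b` and `a`, and `G` becomes abelian modulo `c ^ i`. This is
the only link between the two kernels that the global comparison needs. -/
lemma zpow_sub_one_mem (h : MetacyclicGen a b t) (h' : MetacyclicGen c d t') {i : ℤ}
    (hi : i ∣ (t' : ℤ) - 1) : a ^ ((t : ℤ) - 1) ∈ Subgroup.zpowers (c ^ i) := by
  have := h'.commutator_mem hi b a
  rwa [h.conj, ← zpow_natCast, ← zpow_sub_one] at this

/-- An element that acts by `w` on `⟨a⟩` and by `y` on `⟨c⟩`. -/
lemma agree (h : MetacyclicGen a b t) (h' : MetacyclicGen c d t') {g : G} {w y : ℕ}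
    (hw : g * a * g⁻¹ = a ^ w) (hy : g * c * g⁻¹ = c ^ y) :
    (orderOf a : ℤ) ∣ ((t : ℤ) - 1) * ((w : ℤ) - y) := by
  have h1 := h.zpow_sub_one_mem h' (one_dvd _)
  rw [zpow_one] at h1
  obtain ⟨j, hj⟩ := Subgroup.mem_zpowers_iff.1 h1
  rw [orderOf_dvd_iff_zpow_eq_one, zpow_mul, zpow_sub, mul_inv_eq_one]
  calc (a ^ ((t : ℤ) - 1)) ^ (w : ℤ) = g * a ^ ((t : ℤ) - 1) * g⁻¹ := by
        rw [← conj_zpow, hw, ← zpow_mul, ← zpow_natCast, ← zpow_mul, mul_comm]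
    _ = (a ^ ((t : ℤ) - 1)) ^ (y : ℤ) := by
        rw [← hj, ← conj_zpow, hy, ← zpow_mul, ← zpow_natCast, ← zpow_mul, mul_comm]

/-- `a ^ (t - 1)` lies in `⟨c ^ r⟩`, whose order is `m / r`; so `m` divides `(t - 1) (m / r)`. Used
to show that both factorizations have the same `ε`. -/
lemma dvd_of_dvd_sub_one (h : MetacyclicGen a b t) (h' : MetacyclicGen c d t') [Finite G]
    (hac : orderOf a = orderOf c) {r : ℕ} (hr : r ∣ orderOf a) (hr' : (r : ℤ) ∣ (t' : ℤ) - 1) :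
    (r : ℤ) ∣ (t : ℤ) - 1 := by
  have h1 := h.zpow_sub_one_mem h' hr'
  obtain ⟨j, hj⟩ := Subgroup.mem_zpowers_iff.1 h1
  obtain ⟨q, hq⟩ := hr
  have hpos : 0 < orderOf a := orderOf_pos a
  have hq0 : q ≠ 0 := by rintro rfl; rw [hq, mul_zero] at hpos; exact hpos.ne rfl
  have : a ^ (((t : ℤ) - 1) * q) = 1 := by
    rw [zpow_mul, ← hj, ← zpow_mul, ← zpow_mul, ← mul_assoc]
    have e : (r : ℤ) * j * q = (orderOf c : ℤ) * j := by rw [← hac, hq]; push_cast; ring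
    rw [e, zpow_mul, zpow_natCast, pow_orderOf_eq_one, one_zpow]
  rw [← orderOf_dvd_iff_zpow_eq_one, hq] at this
  push_cast at this
  exact Int.dvd_of_mul_dvd_mul_right (by exact_mod_cast hq0) this

lemma mem_zpowers_iff_dvd (h : MetacyclicGen a b t) (j : ℤ) :
    b ^ j ∈ Subgroup.zpowers a ↔ ((Subgroup.zpowers a).index : ℤ) ∣ j := by
  have : (Subgroup.zpowers a).Normal := by simpa using h.normal 1
  have hgen : ∀ x : G ⧸ Subgroup.zpowers a, x ∈ Subgroup.zpowers (b : G ⧸ Subgroup.zpowers a) := by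
    intro x
    induction x using QuotientGroup.induction_on with
    | H g =>
      obtain ⟨i, j, rfl⟩ := h.span g
      have : (a : G ⧸ Subgroup.zpowers a) = 1 :=
        (QuotientGroup.eq_one_iff a).2 (Subgroup.mem_zpowers a)
      simp only [QuotientGroup.mk_mul, QuotientGroup.mk_pow, this, one_pow, one_mul]
      exact Subgroup.pow_mem _ (Subgroup.mem_zpowers _) _
  rw [Subgroup.index_eq_card, ← orderOf_eq_card_of_forall_mem_zpowers hgen,
    orderOf_dvd_iff_zpow_eq_one, ← QuotientGroup.mk_zpow, QuotientGroup.eq_one_iff]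

/-- Count `|G|` once through `⟨a⟩` and once through `⟨b⟩`, whose order is `n` times that of `b ^ n`.
-/
lemma index_mul_orderOf [Finite G] (h : MetacyclicGen a b t) :
    (Subgroup.zpowers b).index * orderOf (b ^ (Subgroup.zpowers a).index) = orderOf a := by
  have h1 : (Subgroup.zpowers a).index ∣ orderOf b := by
    have := (h.mem_zpowers_iff_dvd (orderOf b)).1 (by
      rw [zpow_natCast, pow_orderOf_eq_one]; exact Subgroup.one_mem _)
    exact_mod_cast this
  have hn : (Subgroup.zpowers a).index ≠ 0 := Subgroup.index_ne_zero_of_finite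
  have e1 := (Subgroup.zpowers b).card_mul_index
  have e2 := (Subgroup.zpowers a).card_mul_index
  rw [Nat.card_zpowers] at e1 e2
  rw [orderOf_pow_of_dvd hn h1]
  obtain ⟨q, hq⟩ := h1
  rw [hq] at e1 ⊢
  rw [Nat.mul_div_cancel_left _ (Nat.pos_of_ne_zero hn)]
  apply Nat.eq_of_mul_eq_mul_right (Nat.pos_of_ne_zero hn)
  rw [e2, ← e1]; ring

/-- `b ^ [G : ⟨a⟩] = a ^ ([G : ⟨b⟩] * k)` with `k` prime to the order of `b ^ [G : ⟨a⟩]`. -/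
lemma pow_index_eq [Finite G] (h : MetacyclicGen a b t) :
    ∃ k : ℕ, b ^ (Subgroup.zpowers a).index = a ^ ((Subgroup.zpowers b).index * k) ∧
      (orderOf (b ^ (Subgroup.zpowers a).index)).Coprime k := by
  have h1 := (h.mem_zpowers_iff_dvd (Subgroup.zpowers a).index).2 dvd_rfl
  rw [zpow_natCast] at h1
  obtain ⟨i, hi⟩ : ∃ j : ℕ, a ^ j = b ^ (Subgroup.zpowers a).index :=
    mem_powers_iff_mem_zpowers.2 h1
  have h2 := h.index_mul_orderOf
  set q := orderOf (b ^ (Subgroup.zpowers a).index) with hq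
  set s := (Subgroup.zpowers b).index
  have hq0 : 0 < q := orderOf_pos _
  have hs0 : 0 < s := Nat.pos_of_ne_zero Subgroup.index_ne_zero_of_finite
  have e3 : q = orderOf a / (orderOf a).gcd i := by
    rw [hq, ← hi, orderOf_pow]
  -- Writing `b ^ n = a ^ i`, the order `q = m / s` of this element forces `gcd (m, i) = s`.
  have hg : (orderOf a).gcd i = s := by
    have h4 : q * (orderOf a).gcd i = orderOf a := by
      rw [e3]; exact Nat.div_mul_cancel (Nat.gcd_dvd_left _ _)
    rw [← h2, mul_comm] at h4
    rw [← h2]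
    exact Nat.eq_of_mul_eq_mul_right hq0 h4
  obtain ⟨k, hk⟩ : s ∣ i := hg ▸ Nat.gcd_dvd_right _ _
  refine ⟨k, by rw [← hk]; exact hi.symm, ?_⟩
  rw [← h2, hk, Nat.gcd_mul_left] at hg
  exact Nat.eq_of_mul_eq_mul_left hs0 (by rw [hg, mul_one])

end MetacyclicGen

/-! ### Congruences for powers, and extraction of `p`-parts. -/

/-- The inequality half of lifting the exponent: each `p`-th power gains a factor `1 + x + ... + x ^
(p - 1)`, which is `0` modulo `p`. As only a lower bound is claimed, `p = 2` needs no exception. -/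
lemma Int.pow_dvd_pow_sub_one {p i j V : ℕ} {x : ℤ} (hi : i ≠ 0)
    (hx : (p : ℤ) ^ i ∣ x - 1) (hV : p ^ j ∣ V) : (p : ℤ) ^ (i + j) ∣ x ^ V - 1 := by
  obtain ⟨V, rfl⟩ := hV
  have key : (p : ℤ) ^ (i + j) ∣ x ^ (p ^ j) - 1 := by
    induction j with
    | zero => simpa using hx
    | succ j ih =>
      have e : x ^ (p ^ (j + 1)) - 1
          = (x ^ (p ^ j) - 1) * ∑ k ∈ Finset.range p, (x ^ (p ^ j)) ^ k := by
        rw [mul_geom_sum, ← pow_mul, pow_succ]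
      rw [e, ← add_assoc, pow_succ]
      refine mul_dvd_mul ih ?_
      have h1 : (p : ℤ) ∣ x ^ (p ^ j) - 1 := (dvd_pow_self _ (by omega)).trans ih
      have h2 : x ^ (p ^ j) ≡ 1 [ZMOD p] := (Int.modEq_iff_dvd.2 h1).symm
      have h3 : (∑ k ∈ Finset.range p, (x ^ (p ^ j)) ^ k) ≡ ∑ k ∈ Finset.range p, 1 ^ k [ZMOD p] :=
        Int.ModEq.sum fun k _ => h2.pow k
      simp only [one_pow, Finset.sum_const, Finset.card_range, nsmul_eq_mul, mul_one] at h3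
      exact (Int.modEq_zero_iff_dvd).1 (h3.trans (by simp [Int.ModEq]))
  rw [pow_mul]
  exact key.trans (sub_one_dvd_pow_sub_one _ _)

lemma Int.geom_sum_modEq {x m : ℤ} (hx : m ∣ x - 1) (n : ℕ) :
    m ∣ (∑ i ∈ Finset.range n, x ^ i) - n := by
  have h3 : (∑ k ∈ Finset.range n, x ^ k) ≡ ∑ k ∈ Finset.range n, 1 ^ k [ZMOD m] :=
    Int.ModEq.sum fun k _ => ((Int.modEq_iff_dvd.2 hx).symm).pow k
  simp only [one_pow, Finset.sum_const, Finset.card_range, nsmul_eq_mul, mul_one] at h3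
  exact Int.modEq_iff_dvd.1 h3.symm

/-- A residue class that is `1` modulo a prime `q` and has order prime to `q` is trivial. -/
lemma Int.prime_pow_dvd_sub_one {q j N : ℕ} (hq : q.Prime) {x : ℤ} (hx : (q : ℤ) ∣ x - 1)
    (hN : ¬ q ∣ N) (h : (q : ℤ) ^ j ∣ x ^ N - 1) : (q : ℤ) ^ j ∣ x - 1 := by
  rw [← mul_geom_sum] at h
  have hq' := Nat.prime_iff_prime_int.1 hq
  refine IsCoprime.dvd_of_dvd_mul_right (IsCoprime.pow_left ?_) h
  rw [Prime.coprime_iff_not_dvd hq']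
  intro h'
  have := (dvd_sub_right h').1 (Int.geom_sum_modEq hx N)
  exact hN (by exact_mod_cast this)

lemma mul_pow_of_conj {G : Type*} [Group G] {α β : G} {z : ℕ} (h : β * α * β⁻¹ = α ^ z)
    (u N : ℕ) : (α ^ u * β) ^ N = α ^ (u * ∑ i ∈ Finset.range N, z ^ i) * β ^ N := by
  have hc : ∀ k N : ℕ, β ^ N * α ^ k = α ^ (k * z ^ N) * β ^ N := by
    intro k N
    induction N with
    | zero => simp
    | succ N ih =>
      have e : β * α ^ (k * z ^ N) = α ^ (k * z ^ N * z) * β := by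
        rw [mul_comm (k * z ^ N) z, pow_mul α z, ← h, conj_pow]; group
      rw [pow_succ', mul_assoc, ih, ← mul_assoc, e, pow_succ, mul_assoc, mul_assoc]
  induction N with
  | zero => simp
  | succ N ih =>
    rw [pow_succ, ih, mul_assoc, ← mul_assoc (β ^ N), hc, Finset.sum_range_succ, mul_add, pow_add,
      pow_succ]
    simp only [mul_assoc]

/-- The exponent that extracts `p`-parts. -/
lemma exists_primary_exponent {P M : ℕ} (h : P.Coprime M) :
    ∃ e : ℕ, (P : ℤ) ∣ (e : ℤ) - 1 ∧ (M : ℤ) ∣ e := by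
  obtain ⟨e, h1, h2⟩ := Nat.chineseRemainder h 1 0
  refine ⟨e, ?_, ?_⟩
  · exact Int.modEq_iff_dvd.1 (Int.natCast_modEq_iff.2 h1.symm)
  · exact_mod_cast (Nat.modEq_zero_iff_dvd).1 h2

/-! ### Two presentations compared at one prime. -/

namespace MetacyclicGen

variable {G : Type*} [Group G] {a b c d : G} {t t' : ℕ}

lemma pow_conj_zpow (h : MetacyclicGen a b t) (V : ℕ) (k : ℤ) :
    b ^ V * a ^ k * (b ^ V)⁻¹ = a ^ (k * (t : ℤ) ^ V) := by
  rw [← conj_zpow, h.pow_conj, ← zpow_natCast, ← zpow_mul]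
  push_cast
  rw [mul_comm]

/-- Since `b ^ V` centralizes the `p'`-part of `⟨a⟩`, that part of `a ^ U` splits off as a commuting
factor. Raising to the power `e` fixes `x` and kills this factor, leaving only the `p`-part `a ^ e`
of `a`. -/
lemma exists_split (h : MetacyclicGen a b t) {e P mp mq : ℕ} (hPe : (P : ℤ) ∣ (e : ℤ) - 1)
    (hGe : ∀ g : G, g ^ ((e : ℤ) * (1 - e)) = 1) (hm : orderOf a = mp * mq) (hmp : mp ∣ P)
    {x : G} (hx : x ^ P = 1) (hz : ∀ U V : ℕ, x = a ^ U * b ^ V → (mq : ℤ) ∣ (t : ℤ) ^ V - 1) :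
    ∃ u V : ℕ, x = (a ^ e) ^ u * b ^ V ∧ (mq : ℤ) ∣ (t : ℤ) ^ V - 1 := by
  obtain ⟨U, V, hUV⟩ := h.span x
  have hV := hz U V hUV
  have hmp' : (mp : ℤ) ∣ 1 - (e : ℤ) := by
    rw [← neg_sub]; exact ((Int.natCast_dvd_natCast.2 hmp).trans hPe).neg_right
  have hdvd : (orderOf a : ℤ) ∣ (1 - e) * U * ((t : ℤ) ^ V - 1) := by
    rw [hm]; push_cast
    exact mul_dvd_mul (hmp'.mul_right _) hV
  have hcb : Commute (b ^ V) (a ^ ((1 - (e : ℤ)) * U)) := by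
    have h1 := h.pow_conj_zpow V ((1 - (e : ℤ)) * U)
    have h2 : a ^ ((1 - (e : ℤ)) * U * (t : ℤ) ^ V) = a ^ ((1 - (e : ℤ)) * U) := by
      have h3 := orderOf_dvd_iff_zpow_eq_one.1 hdvd
      rw [mul_sub, mul_one, zpow_sub, mul_inv_eq_one] at h3
      exact h3
    rw [h2] at h1
    exact mul_inv_eq_iff_eq_mul.1 h1
  have hca : Commute ((a ^ e) ^ U) (a ^ ((1 - (e : ℤ)) * U)) := by
    rw [← pow_mul, ← zpow_natCast]
    exact Commute.zpow_zpow_self _ _ _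
  have hxy : x = (a ^ e) ^ U * b ^ V * a ^ ((1 - (e : ℤ)) * U) := by
    rw [mul_assoc, hcb.eq, ← mul_assoc, hUV, ← pow_mul, ← zpow_natCast, ← zpow_natCast a (e * U),
      ← zpow_add]
    congr 2
    push_cast; ring
  have hxe : x = x ^ e := by
    obtain ⟨j, hj⟩ := hPe
    rw [← zpow_natCast, show (e : ℤ) = P * j + 1 by linarith, zpow_add, zpow_mul, zpow_natCast, hx]
    simp
  have h4 : (a ^ ((1 - (e : ℤ)) * U)) ^ e = 1 := by
    rw [← zpow_natCast, ← zpow_mul, show (1 - (e : ℤ)) * U * e = e * (1 - e) * U by ring,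
      zpow_mul, hGe, one_zpow]
  have h5 : b ^ V * a ^ e * (b ^ V)⁻¹ = (a ^ e) ^ (t ^ V) := by
    rw [← conj_pow, h.pow_conj, ← pow_mul, ← pow_mul, mul_comm]
  refine ⟨U * ∑ i ∈ Finset.range e, (t ^ V) ^ i, V * e, ?_, ?_⟩
  · conv_lhs => rw [hxe, hxy]
    rw [(hca.mul_left hcb).mul_pow, h4, mul_one, mul_pow_of_conj h5, pow_mul b]
  · rw [pow_mul]
    exact hV.trans (sub_one_dvd_pow_sub_one _ _)

/-- Comparison of the action of an element on two cyclic subgroups. -/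
lemma zpow_eq_of_conj {α β g : G} {u w y z : ℕ} {l : ℤ} (hβ : β * α * β⁻¹ = α ^ z)
    (hα : g * α * g⁻¹ = α ^ w) (hx : g * (α ^ u * β) * g⁻¹ = (α ^ u * β) ^ y)
    (hgβ : g * β * g⁻¹ = α ^ (l * (1 - z)) * β) :
    α ^ ((u : ℤ) * w + l * (1 - z) - u * ∑ i ∈ Finset.range y, (z : ℤ) ^ i)
      = β ^ ((y : ℤ) - 1) := by
  have e1 : g * (α ^ u * β) * g⁻¹ = α ^ (u * w) * (α ^ (l * (1 - z)) * β) := by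
    rw [← hgβ, mul_comm u w, pow_mul, ← hα, conj_pow]; group
  rw [mul_pow_of_conj hβ, e1] at hx
  rw [zpow_sub, zpow_sub_one, zpow_natCast β, eq_mul_inv_iff_mul_eq, zpow_add]
  have e2 : α ^ ((u : ℤ) * w) = α ^ (u * w) := by rw [← zpow_natCast]; push_cast; rfl
  have e3 : α ^ ((u : ℤ) * ∑ i ∈ Finset.range y, (z : ℤ) ^ i)
      = α ^ (u * ∑ i ∈ Finset.range y, z ^ i) := by rw [← zpow_natCast]; push_cast; rfl
  rw [e2, e3]
  have e4 : Commute ((α ^ (u * ∑ i ∈ Finset.range y, z ^ i))⁻¹)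
      (α ^ (u * w) * α ^ (l * (1 - z))) := by
    refine Commute.inv_left ?_
    exact (Commute.pow_pow_self _ _ _).mul_right ((Commute.refl α).pow_left _ |>.zpow_right _)
  rw [← e4.eq, mul_assoc, inv_mul_eq_iff_eq_mul, ← hx, mul_assoc]

end MetacyclicGen

namespace MetacyclicGen

variable {G : Type*} [Group G] {a b c d : G} {t t' : ℕ}

/-- If `p` divided both `u` and `j`, then modulo `a ^ p` the element `a ^ e` would be a power of
`b`. So some power of `a` with exponent prime to `p` would commute with `b`, making the action
trivial on the `p`-part of `⟨a⟩`. This is what makes `u` a unit modulo `p`. -/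
lemma dvd_of_dvd_exponents [Finite G] (h : MetacyclicGen a b t) {p e l k u V i j μ : ℕ}
    (hp : p.Prime) (hd : d = a ^ l * b ^ k) (hpt : (p : ℤ) ∣ (t : ℤ) - 1)
    (he : (p : ℤ) ∣ (e : ℤ) - 1) (hx : c ^ e = (a ^ e) ^ u * b ^ V)
    (ha : a = c ^ i * d ^ j) (hj : p ∣ j) (hu : p ∣ u) (hμ : p ^ μ ∣ orderOf a) :
    (p : ℤ) ^ μ ∣ (t : ℤ) - 1 := by
  have hp' := Nat.prime_iff_prime_int.1 hp
  have := h.normal p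
  set N := Subgroup.zpowers (a ^ (p : ℤ)) with hN
  have hcomm := h.commute_quotient hpt N (Subgroup.mem_zpowers _)
  have hap : (a : G ⧸ N) ^ p = 1 := by
    rw [← QuotientGroup.mk_pow, QuotientGroup.eq_one_iff, ← zpow_natCast]
    exact Subgroup.mem_zpowers _
  have hap' : ∀ v, p ∣ v → (a : G ⧸ N) ^ v = 1 := by
    rintro _ ⟨v, rfl⟩
    rw [pow_mul, hap, one_pow]
  have hce : (c : G ⧸ N) ^ e = (b : G ⧸ N) ^ V := by
    have := congrArg (QuotientGroup.mk (s := N)) hx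
    simp only [QuotientGroup.mk_mul, QuotientGroup.mk_pow] at this
    rw [this, ← pow_mul, hap' _ (hu.mul_left e), one_mul]
  have hde : (d : G ⧸ N) ^ (j * e) = (b : G ⧸ N) ^ (k * (j * e)) := by
    rw [hd]
    simp only [QuotientGroup.mk_mul, QuotientGroup.mk_pow]
    rw [((hcomm a b).pow_pow _ _).mul_pow, ← pow_mul, ← pow_mul,
      hap' _ ((hj.mul_right e).mul_left l), one_mul]
  have hae : (a : G ⧸ N) ^ e = (b : G ⧸ N) ^ (V * i + k * (j * e)) := by
    have e1 := congrArg (QuotientGroup.mk (s := N)) ha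
    simp only [QuotientGroup.mk_mul, QuotientGroup.mk_pow] at e1
    rw [e1, ((hcomm c d).pow_pow _ _).mul_pow, ← pow_mul, ← pow_mul, hde, mul_comm i e, pow_mul,
      hce, ← pow_mul, pow_add]
  have hmem : a ^ e * (b ^ (V * i + k * (j * e)))⁻¹ ∈ N := by
    rw [← QuotientGroup.eq_one_iff]
    simp only [QuotientGroup.mk_mul, QuotientGroup.mk_pow, QuotientGroup.mk_inv]
    rw [hae, mul_inv_cancel]
  obtain ⟨v, hv⟩ := Subgroup.mem_zpowers_iff.1 hmem
  -- Here `e ≡ 1` modulo `p`, so the exponent `e - p * v` is prime to `p`.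
  have hb : a ^ ((e : ℤ) - p * v) = b ^ (V * i + k * (j * e)) := by
    rw [← zpow_mul] at hv
    rw [sub_eq_neg_add, zpow_add, zpow_neg, hv, zpow_natCast]
    group
  have hcb : b * a ^ ((e : ℤ) - p * v) * b⁻¹ = a ^ ((e : ℤ) - p * v) := by
    rw [hb, ((Commute.refl b).pow_right _).eq, mul_inv_cancel_right]
  have h2 := h.pow_conj_zpow 1 ((e : ℤ) - p * v)
  rw [pow_one, pow_one, hcb, eq_comm] at h2
  have h3 : a ^ (((e : ℤ) - p * v) * ((t : ℤ) - 1)) = 1 := by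
    rw [mul_sub, mul_one, zpow_sub, h2, mul_inv_cancel]
  rw [← orderOf_dvd_iff_zpow_eq_one] at h3
  have h4 : (p : ℤ) ^ μ ∣ ((e : ℤ) - p * v) * ((t : ℤ) - 1) :=
    (by exact_mod_cast hμ : (p : ℤ) ^ μ ∣ (orderOf a : ℤ)).trans h3
  refine IsCoprime.dvd_of_dvd_mul_left (IsCoprime.pow_left ?_) h4
  rw [Prime.coprime_iff_not_dvd hp']
  intro h5
  have h6 : (p : ℤ) ∣ e := by
    have := dvd_add h5 (dvd_mul_right (p : ℤ) v)
    rwa [sub_add_cancel] at this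
  have h7 : (p : ℤ) ∣ 1 := by
    have := dvd_sub h6 he
    rwa [sub_sub_cancel] at this
  exact hp'.not_dvd_one h7

/-- Two metacyclic presentations of a group, compared at a prime `p`. -/
lemma exists_exponents [Finite G] (h : MetacyclicGen a b t) (h' : MetacyclicGen c d t')
    {p l k k₀ μ mq : ℕ} (hp : p.Prime) (hd : d = a ^ l * b ^ k)
    (hm : orderOf a = p ^ μ * mq) (hmq : ¬ p ∣ mq) (hμ : μ ≠ 0)
    (hk₀ : b ^ (Subgroup.zpowers a).index = a ^ ((Subgroup.zpowers b).index * k₀)) :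
    ∃ (u V : ℕ) (f : ℤ), (mq : ℤ) ∣ (t : ℤ) ^ V - 1 ∧
      ((p : ℤ) ∣ (t : ℤ) - 1 → (∀ i j : ℕ, a = c ^ i * d ^ j → p ∣ j) → p ∣ u →
        (p : ℤ) ^ μ ∣ (t : ℤ) - 1) ∧
      (V : ℤ) * ((t' : ℤ) - 1) = (Subgroup.zpowers a).index * f ∧
      (p : ℤ) ^ μ ∣ (u : ℤ) * (t : ℤ) ^ k + l * (1 - (t : ℤ) ^ V)
        - u * ∑ i ∈ Finset.range t', ((t : ℤ) ^ V) ^ i - (Subgroup.zpowers b).index * k₀ * f := by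
  obtain ⟨ν, M, hM, hcard⟩ := Nat.exists_eq_pow_mul_and_not_dvd
    (Nat.card_pos (α := G)).ne' p hp.ne_one
  obtain ⟨e, hPe, hMe⟩ := exists_primary_exponent (((Nat.Prime.coprime_iff_not_dvd hp).2 hM).pow_left ν)
  have hGe : ∀ g : G, g ^ ((e : ℤ) * (1 - e)) = 1 := by
    intro g
    rw [← orderOf_dvd_iff_zpow_eq_one]
    refine (Int.natCast_dvd_natCast.2 (orderOf_dvd_natCard g)).trans ?_
    rw [hcard, mul_comm (e : ℤ)]; push_cast
    refine mul_dvd_mul ?_ hMe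
    rw [← neg_sub]
    exact (by exact_mod_cast hPe : (p : ℤ) ^ ν ∣ (e : ℤ) - 1).neg_right
  have hmp : p ^ μ ∣ p ^ ν := by
    have h1 : p ^ μ ∣ p ^ ν * M :=
      (Dvd.intro _ hm.symm).trans (hcard ▸ orderOf_dvd_natCard a)
    exact (((Nat.Prime.coprime_iff_not_dvd hp).2 hM).pow_left μ).dvd_of_dvd_mul_right h1
  have hμe : (p : ℤ) ^ μ ∣ (e : ℤ) - 1 :=
    (by exact_mod_cast hmp : (p : ℤ) ^ μ ∣ ((p ^ ν : ℕ) : ℤ)).trans hPe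
  have hx : (c ^ e) ^ (p ^ ν) = 1 := by
    obtain ⟨j, hj⟩ := hMe
    have hj' : (e * p ^ ν : ℤ) = Nat.card G * j := by rw [hcard, hj]; push_cast; ring
    rw [← pow_mul, ← zpow_natCast]
    push_cast
    rw [hj', zpow_mul, zpow_natCast, pow_card_eq_one', one_zpow]
  -- The `p`-part of `c` acts trivially on `c`. At a prime `q ∣ mq` not dividing `t - 1`, `agree`
  -- then yields `t ^ V ≡ 1`. At a prime `q ∣ t - 1`, the class of `t ^ V` is `1` modulo `q` and has
  -- `p`-power order, so it is trivial modulo the `q`-part of `m`.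
  have hz : ∀ U V : ℕ, c ^ e = a ^ U * b ^ V → (mq : ℤ) ∣ (t : ℤ) ^ V - 1 := by
    intro U V hUV
    have hw := h.conj_eq hUV
    have hy : c ^ e * c * (c ^ e)⁻¹ = c ^ 1 := by group
    have hag := h.agree h' hw hy
    have hord : (orderOf a : ℤ) ∣ ((t : ℤ) ^ V) ^ (p ^ ν) - 1 := by
      have e1 : (c ^ e) ^ (p ^ ν) * a * ((c ^ e) ^ (p ^ ν))⁻¹ = a ^ ((t ^ V) ^ (p ^ ν)) := by
        generalize c ^ e = x at hw
        generalize p ^ ν = n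
        induction n with
        | zero => simp
        | succ n ih =>
          have e3 : x ^ (n + 1) * a * (x ^ (n + 1))⁻¹ = x ^ n * (x * a * x⁻¹) * (x ^ n)⁻¹ := by
            rw [pow_succ]; group
          rw [e3, hw, ← conj_pow, ih, ← pow_mul, pow_succ]
      rw [hx, one_mul, inv_one, mul_one] at e1
      rw [orderOf_dvd_iff_zpow_eq_one, zpow_sub_one, mul_inv_eq_one]
      conv_rhs => rw [e1]
      rw [← zpow_natCast]; push_cast; rfl
    have hmq' : (mq : ℤ) ∣ orderOf a := by rw [hm]; push_cast; exact dvd_mul_left _ _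
    rw [Int.natCast_dvd, Nat.dvd_iff_prime_pow_dvd_dvd]
    intro q j hq hqj
    rw [← Int.natCast_dvd]
    have hqj' := (Int.natCast_dvd_natCast.2 hqj).trans hmq'
    have hord' := hqj'.trans hord
    have hag' := hqj'.trans hag
    push_cast at hord' hag' ⊢
    by_cases hj : j = 0
    · simp [hj]
    have hqp : ¬ q ∣ p ^ ν := by
      intro hqp
      obtain rfl := (Nat.prime_dvd_prime_iff_eq hq hp).1 (hq.dvd_of_dvd_pow hqp)
      exact hmq ((dvd_pow_self _ hj).trans hqj)
    by_cases hqt : (q : ℤ) ∣ (t : ℤ) - 1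
    · exact Int.prime_pow_dvd_sub_one hq (hqt.trans (sub_one_dvd_pow_sub_one _ _)) hqp hord'
    · exact IsCoprime.dvd_of_dvd_mul_left (IsCoprime.pow_left
        ((Prime.coprime_iff_not_dvd (Nat.prime_iff_prime_int.1 hq)).2 hqt)) hag'
  obtain ⟨u, V, hxe, hV⟩ := h.exists_split hPe hGe hm hmp hx hz
  have hm1 : (orderOf a : ℤ) ∣ ((e : ℤ) - 1) * ((t : ℤ) ^ V - 1) := by
    rw [hm]; push_cast
    exact mul_dvd_mul hμe hV
  have hβ : b ^ V * a ^ e * (b ^ V)⁻¹ = (a ^ e) ^ (t ^ V) := by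
    rw [← conj_pow, h.pow_conj, ← pow_mul, ← pow_mul, mul_comm]
  have hα : d * a ^ e * d⁻¹ = (a ^ e) ^ (t ^ k) := by
    rw [← conj_pow, h.conj_eq hd, ← pow_mul, ← pow_mul, mul_comm]
  have hdx : d * ((a ^ e) ^ u * b ^ V) * d⁻¹ = ((a ^ e) ^ u * b ^ V) ^ t' := by
    rw [← hxe, ← conj_pow, h'.conj, ← pow_mul, ← pow_mul, mul_comm]
  -- Directly, the conjugate is `a ^ (l * (1 - t ^ V)) * b ^ V`. Replacing `a` by its `p`-part `a ^
  -- e` changes nothing, as `m ∣ (e - 1) (t ^ V - 1)`.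
  have hdβ : d * b ^ V * d⁻¹ = (a ^ e) ^ ((l : ℤ) * (1 - (t ^ V : ℕ))) * b ^ V := by
    have e1 : d * b ^ V * d⁻¹ = a ^ l * (b ^ V * a ^ (-(l : ℤ)) * (b ^ V)⁻¹) * b ^ V := by
      have : d * b ^ V * d⁻¹ = a ^ l * (b ^ k * b ^ V * (b ^ k)⁻¹) * (a ^ l)⁻¹ := by
        rw [hd]; group
      rw [this, (Commute.pow_pow_self b k V).eq, mul_inv_cancel_right, zpow_neg, zpow_natCast]
      group
    rw [e1, h.pow_conj_zpow, ← zpow_natCast, ← zpow_add, ← zpow_natCast a e, ← zpow_mul]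
    congr 1
    rw [← mul_inv_eq_one, ← zpow_sub, ← orderOf_dvd_iff_zpow_eq_one]
    push_cast
    have := hm1.mul_right l
    have e2 : (l : ℤ) + -l * t ^ V - e * (l * (1 - t ^ V))
      = ((e : ℤ) - 1) * ((t : ℤ) ^ V - 1) * l := by ring
    rwa [e2]
  have hE := zpow_eq_of_conj hβ hα hdx hdβ
  rw [← zpow_natCast a e, ← zpow_mul] at hE
  have hbV : (b ^ V) ^ ((t' : ℤ) - 1) = b ^ ((V : ℤ) * ((t' : ℤ) - 1)) := by
    rw [zpow_mul, zpow_natCast]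
  rw [hbV] at hE
  -- The congruence exhibits `b ^ (V * (t' - 1))` as an element of `⟨a⟩`, so `n` divides this
  -- exponent; `f` is the quotient.
  obtain ⟨f, hf⟩ := (h.mem_zpowers_iff_dvd _).1 (Subgroup.mem_zpowers_iff.2 ⟨_, hE⟩)
  refine ⟨u, V, f, hV, ?_, hf, ?_⟩
  · intro hpt hj hu
    obtain ⟨i, j, hij⟩ := h'.span a
    exact h.dvd_of_dvd_exponents hp hd hpt ((dvd_pow_self _ hμ).trans hμe) hxe hij (hj i j hij) hu
      (Dvd.intro _ hm.symm)
  · rw [hf, zpow_mul b, zpow_natCast b, hk₀, ← zpow_natCast, ← zpow_mul, ← mul_inv_eq_one, ← zpow_sub,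
      ← orderOf_dvd_iff_zpow_eq_one] at hE
    have h1 : (p : ℤ) ^ μ ∣ orderOf a := by rw [hm]; push_cast; exact dvd_mul_right _ _
    have h2 := h1.trans hE
    push_cast at h2
    -- Multiplying by `e` does nothing modulo `p ^ μ`, so the factor is removed.
    set E := (u : ℤ) * (t : ℤ) ^ k + l * (1 - (t : ℤ) ^ V)
        - u * ∑ i ∈ Finset.range t', ((t : ℤ) ^ V) ^ i
    have h3 := dvd_sub h2 (hμe.mul_right E)
    have e3 : (e : ℤ) * E - (Subgroup.zpowers b).index * k₀ * f - (e - 1) * E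
      = E - (Subgroup.zpowers b).index * k₀ * f := by ring
    rwa [e3] at h3

end MetacyclicGen

/-! ### Arithmetic of the invariants `r` and `o`. -/

namespace Metacyclic

/-- An element of the image of order prime to `ν` is lifted, and the `ν`-part of its lift is removed
by a power that does not move the image. -/
lemma hallCompl_map {U W : Type*} [CommGroup U] [Finite U] [CommGroup W] (ν : Finset ℕ)
    (f : U →* W) (T : Subgroup U) : (hallCompl ν T).map f = hallCompl ν (T.map f) := by
  ext y
  constructor
  · rintro ⟨x, ⟨hx, hc⟩, rfl⟩
    exact ⟨⟨x, hx, rfl⟩, Nat.Coprime.coprime_dvd_left (orderOf_map_dvd f x) hc⟩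
  · rintro ⟨⟨x, hx, rfl⟩, hc⟩
    set K := ∏ p ∈ ν, p
    set N := orderOf x with hN
    have hN0 : 0 < N := orderOf_pos x
    have hy : orderOf (f x) ∣ N := orderOf_map_dvd f x
    have hφ : 0 < (orderOf (f x)).totient := Nat.totient_pos.2 (Nat.pos_of_dvd_of_pos hy hN0)
    -- The factor `totient` makes `k ≡ 1` modulo the order of `f x` by Euler; the factor `N` makes
    -- the exponent large enough for `k` to absorb every `ν`-part of `N`.
    set k := K ^ ((orderOf (f x)).totient * N) with hk
    refine ⟨x ^ k, ⟨T.pow_mem hx _, ?_⟩, ?_⟩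
    · refine Nat.Coprime.symm (Nat.coprime_of_dvd fun q hq hqK hqo => ?_)
      rw [orderOf_pow, ← hN] at hqo
      obtain ⟨v, w, hw, hNv⟩ := Nat.exists_eq_pow_mul_and_not_dvd hN0.ne' q hq.ne_one
      have hv : v < N := by
        calc v < q ^ v := Nat.lt_pow_self hq.one_lt
          _ ≤ N := Nat.le_of_dvd hN0 (hNv ▸ dvd_mul_right _ _)
      have h1 : q ^ v ∣ N.gcd k := Nat.dvd_gcd (hNv ▸ dvd_mul_right _ _)
        ((pow_dvd_pow_of_dvd hqK v).trans (pow_dvd_pow K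
          (hv.le.trans (Nat.le_mul_of_pos_left N hφ))))
      have h2 : q * q ^ v ∣ N := by
        have := mul_dvd_mul hqo h1
        rwa [Nat.div_mul_cancel (Nat.gcd_dvd_left _ _)] at this
      rw [hNv, mul_comm] at h2
      exact hw (Nat.dvd_of_mul_dvd_mul_left (pow_pos hq.pos v) h2)
    · rw [map_pow]
      have h1 : k ≡ 1 [MOD orderOf (f x)] := by
        rw [hk, pow_mul]
        simpa using (Nat.ModEq.pow_totient hc.symm).pow N
      simpa using pow_eq_pow_iff_modEq.2 h1

lemma card_hallCompl_zpowers_dvd {U : Type*} [CommGroup U] (ν : Finset ℕ) {σ : U} {V : ℕ}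
    (h : σ ^ V = 1) : Nat.card (hallCompl ν (Subgroup.zpowers σ)) ∣ V := by
  have h1 : hallCompl ν (Subgroup.zpowers σ) ≤ Subgroup.zpowers σ := fun x hx => hx.1
  refine (Subgroup.card_dvd_of_le h1).trans ?_
  rw [Nat.card_zpowers]
  exact orderOf_dvd_of_pow_eq_one h

lemma prime_dvd_card_hallCompl {U : Type*} [CommGroup U] [Finite U] {ν : Finset ℕ} {σ : U}
    {p : ℕ} (hp : p.Prime) (hν : ∀ q ∈ ν, q.Prime) (hpν : p ∉ ν) (h : p ∣ orderOf σ) :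
    p ∣ Nat.card (hallCompl ν (Subgroup.zpowers σ)) := by
  obtain ⟨w, hw⟩ := h
  have hw0 : w ≠ 0 := by
    rintro rfl
    exact (orderOf_pos σ).ne' (by simpa using hw)
  have ho : orderOf (σ ^ w) = p := by
    rw [orderOf_pow_of_dvd hw0 (hw ▸ dvd_mul_left _ _), hw,
      Nat.mul_div_cancel _ (Nat.pos_of_ne_zero hw0)]
  have hmem : σ ^ w ∈ hallCompl ν (Subgroup.zpowers σ) := by
    refine ⟨Subgroup.pow_mem _ (Subgroup.mem_zpowers _) _, ?_⟩
    rw [ho]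
    refine Nat.Coprime.prod_right fun q hq => ?_
    refine (Nat.coprime_primes hp (hν q hq)).2 ?_
    rintro rfl
    exact hpν hq
  have := orderOf_dvd_natCard (⟨σ ^ w, hmem⟩ : hallCompl ν (Subgroup.zpowers σ))
  rwa [Subgroup.orderOf_mk, ho] at this

section

variable {m : ℕ} {τ : (ZMod m)ˣ} {t : ℕ}

lemma unitsMap_val_eq (ht : (τ : ZMod m) = t) {q : ℕ} (hq : q ∣ m) :
    ((ZMod.unitsMap hq τ : (ZMod q)ˣ) : ZMod q) = t := by
  rw [ZMod.unitsMap_def, Units.coe_map, ht]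
  simp

lemma units_eq_one_iff {q : ℕ} {σ : (ZMod q)ˣ} (ht : (σ : ZMod q) = t) :
    σ = 1 ↔ (q : ℤ) ∣ (t : ℤ) - 1 := by
  rw [← ZMod.intCast_zmod_eq_zero_iff_dvd, ← Units.val_inj, ht]
  push_cast
  rw [sub_eq_zero]

lemma units_eq_neg_one_iff {q : ℕ} {σ : (ZMod q)ˣ} (ht : (σ : ZMod q) = t) :
    σ = -1 ↔ (q : ℤ) ∣ (t : ℤ) + 1 := by
  rw [← ZMod.intCast_zmod_eq_zero_iff_dvd, ← Units.val_inj, ht]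
  push_cast
  rw [← eq_neg_iff_add_eq_zero]

lemma res_zpowers {q : ℕ} (hq : q ∣ m) :
    res q (Subgroup.zpowers τ) = Subgroup.zpowers (ZMod.unitsMap hq τ) := by
  rw [res, dif_pos hq, MonoidHom.map_zpowers]

lemma res_eq_bot_iff (ht : (τ : ZMod m) = t) {q : ℕ} (hq : q ∣ m) :
    res q (Subgroup.zpowers τ) = ⊥ ↔ (q : ℤ) ∣ (t : ℤ) - 1 := by
  rw [res_zpowers hq, Subgroup.zpowers_eq_bot, units_eq_one_iff (unitsMap_val_eq ht hq)]

lemma res_le_iff (ht : (τ : ZMod m) = t) {q : ℕ} (hq : q ∣ m) :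
    res q (Subgroup.zpowers τ) ≤ Subgroup.zpowers (-1) ↔
      (q : ℤ) ∣ (t : ℤ) - 1 ∨ (q : ℤ) ∣ (t : ℤ) + 1 := by
  rw [res_zpowers hq, Subgroup.zpowers_le, ← units_eq_one_iff (unitsMap_val_eq ht hq),
    ← units_eq_neg_one_iff (unitsMap_val_eq ht hq)]
  constructor
  · intro h
    obtain ⟨k, hk⟩ := Subgroup.mem_zpowers_iff.1 h
    rw [← hk]
    rcases Int.even_or_odd k with h | h
    · exact Or.inl h.neg_one_zpow
    · exact Or.inr h.neg_one_zpow
  · rintro (h | h)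
    · rw [h]; exact Subgroup.one_mem _
    · rw [h]; exact Subgroup.mem_zpowers _

/-- The numbers among which `invR` is the greatest. -/
def IsAdmissible (m t d : ℕ) : Prop :=
  d ∣ m ∧ (∀ x : ℕ, Odd x → x ∣ d → (x : ℤ) ∣ (t : ℤ) - 1) ∧
    ∀ j : ℕ, 2 ^ j ∣ d → (2 : ℤ) ^ j ∣ (t : ℤ) - 1 ∨ (2 : ℤ) ^ j ∣ (t : ℤ) + 1

lemma part_dvd (p d : ℕ) : part p d ∣ d := Nat.ordProj_dvd d p

lemma isAdmissible_iff (hm : m ≠ 0) (ht : (τ : ZMod m) = t) (d : ℕ) :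
    (d ∈ m.divisors ∧ res (d / part 2 d) (Subgroup.zpowers τ) = ⊥ ∧
      res (part 2 d) (Subgroup.zpowers τ) ≤ Subgroup.zpowers (-1)) ↔ IsAdmissible m t d := by
  rw [Nat.mem_divisors, IsAdmissible, and_iff_left hm]
  refine and_congr_right fun hd => ?_
  have hd0 : d ≠ 0 := ne_zero_of_dvd_ne_zero hm hd
  rw [res_eq_bot_iff ht ((Nat.div_dvd_of_dvd (part_dvd 2 d)).trans hd),
    res_le_iff ht ((part_dvd 2 d).trans hd)]
  have hodd : Odd (d / part 2 d) := by
    rw [← Nat.not_even_iff_odd, even_iff_two_dvd]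
    exact Nat.not_dvd_ordCompl Nat.prime_two hd0
  constructor
  · rintro ⟨h1, h2⟩
    refine ⟨fun x hx hxd => (Int.natCast_dvd_natCast.2 ?_).trans h1, fun j hj => ?_⟩
    · have : x ∣ part 2 d * (d / part 2 d) := by
        rwa [Nat.mul_div_cancel' (part_dvd 2 d)]
      exact (((Nat.coprime_two_right.2 hx).pow_right _)).dvd_of_dvd_mul_left this
    · have h3 : ((2 ^ j : ℕ) : ℤ) ∣ (part 2 d : ℕ) := Int.natCast_dvd_natCast.2
        (pow_dvd_pow 2 ((Nat.prime_two.pow_dvd_iff_le_factorization hd0).1 hj))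
      push_cast at h3
      exact h2.imp h3.trans h3.trans
  · rintro ⟨h1, h2⟩
    refine ⟨h1 _ hodd (Nat.div_dvd_of_dvd (part_dvd 2 d)), ?_⟩
    have := h2 _ (part_dvd 2 d)
    unfold part
    push_cast
    exact this

lemma invR_isAdmissible (hm : m ≠ 0) (ht : (τ : ZMod m) = t) :
    IsAdmissible m t (invR (Subgroup.zpowers τ)) := by
  classical
  have h1 : (1 : ℕ) ∈ (m.divisors.filter fun d =>
      res (d / part 2 d) (Subgroup.zpowers τ) = ⊥ ∧
        res (part 2 d) (Subgroup.zpowers τ) ≤ Subgroup.zpowers (-1)) :=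
    Finset.mem_filter.2 ⟨by simp [hm], res_one_div_part _⟩
  obtain ⟨d, hd, e⟩ := Finset.exists_mem_eq_sup _ ⟨1, h1⟩ (id : ℕ → ℕ)
  have : invR (Subgroup.zpowers τ) = d := by
    unfold invR
    refine Eq.trans ?_ e
    congr
  rw [this]
  exact (isAdmissible_iff hm ht d).1 (Finset.mem_filter.1 hd)

lemma le_invR (hm : m ≠ 0) (ht : (τ : ZMod m) = t) {d : ℕ} (hd : IsAdmissible m t d) :
    d ≤ invR (Subgroup.zpowers τ) := by
  classical
  have hmem : d ∈ m.divisors.filter fun d =>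
      res (d / part 2 d) (Subgroup.zpowers τ) = ⊥ ∧
        res (part 2 d) (Subgroup.zpowers τ) ≤ Subgroup.zpowers (-1) :=
    Finset.mem_filter.2 ((isAdmissible_iff hm ht d).2 hd)
  have := Finset.le_sup (f := id) hmem
  unfold invR
  refine this.trans (le_of_eq ?_)
  congr

/-- Turns "greatest" in size into "greatest" for divisibility: an admissible common multiple of `r`
and `d` cannot exceed `r`. -/
lemma dvd_invR_of_isAdmissible_lcm (hm : m ≠ 0) (ht : (τ : ZMod m) = t) {d : ℕ}
    (hd : IsAdmissible m t ((invR (Subgroup.zpowers τ)).lcm d)) :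
    d ∣ invR (Subgroup.zpowers τ) := by
  have h1 := le_invR hm ht hd
  have hr : invR (Subgroup.zpowers τ) ≠ 0 := ne_zero_of_dvd_ne_zero hm (invR_dvd hm _)
  have h2 : (invR (Subgroup.zpowers τ)).lcm d = invR (Subgroup.zpowers τ) :=
    le_antisymm h1 (Nat.le_of_dvd (Nat.pos_of_ne_zero (ne_zero_of_dvd_ne_zero hm hd.1))
      (Nat.dvd_lcm_left _ _))
  exact h2 ▸ Nat.dvd_lcm_right _ _

lemma prime_pow_dvd_invR (hm : m ≠ 0) (ht : (τ : ZMod m) = t) {p i : ℕ} (hp : Odd p)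
    (hpm : p ^ i ∣ m) (hpt : (p : ℤ) ^ i ∣ (t : ℤ) - 1) : p ^ i ∣ invR (Subgroup.zpowers τ) := by
  apply dvd_invR_of_isAdmissible_lcm hm ht
  obtain ⟨h1, h2, h3⟩ := invR_isAdmissible hm ht
  set r := invR (Subgroup.zpowers τ)
  have hr0 : r ≠ 0 := ne_zero_of_dvd_ne_zero hm h1
  have hodd : Odd (r / part 2 r) := by
    rw [← Nat.not_even_iff_odd, even_iff_two_dvd]
    exact Nat.not_dvd_ordCompl Nat.prime_two hr0
  have hr : r = part 2 r * (r / part 2 r) := (Nat.mul_div_cancel' (part_dvd 2 r)).symm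
  have hL : r.lcm (p ^ i) ∣ part 2 r * (r / part 2 r).lcm (p ^ i) := by
    refine Nat.lcm_dvd ?_ ((Nat.dvd_lcm_right _ _).mul_left _)
    conv_lhs => rw [hr]
    exact mul_dvd_mul_left _ (Nat.dvd_lcm_left _ _)
  have hLodd : Odd ((r / part 2 r).lcm (p ^ i)) :=
    Odd.of_dvd_nat (hodd.mul (hp.pow)) (Nat.lcm_dvd_mul _ _)
  refine ⟨Nat.lcm_dvd h1 hpm, fun x hx hxL => ?_, fun j hj => h3 j ?_⟩
  · have h4 : x ∣ (r / part 2 r).lcm (p ^ i) :=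
      ((Nat.coprime_two_right.2 hx).pow_right _).dvd_of_dvd_mul_left (hxL.trans hL)
    refine (Int.natCast_dvd_natCast.2 h4).trans ?_
    rw [Int.natCast_dvd]
    refine Nat.lcm_dvd (Int.natCast_dvd.1 (h2 _ hodd (Nat.div_dvd_of_dvd (part_dvd 2 r)))) ?_
    rw [← Int.natCast_dvd]
    exact_mod_cast hpt
  · have h4 : 2 ^ j ∣ part 2 r :=
      ((Nat.coprime_two_left.2 hLodd).pow_left j).dvd_of_dvd_mul_right (hj.trans hL)
    exact h4.trans (part_dvd 2 r)

lemma two_pow_dvd_invR (hm : m ≠ 0) (ht : (τ : ZMod m) = t) {i : ℕ}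
    (hpm : 2 ^ i ∣ m) (hpt : (2 : ℤ) ^ i ∣ (t : ℤ) - 1 ∨ (2 : ℤ) ^ i ∣ (t : ℤ) + 1) :
    2 ^ i ∣ invR (Subgroup.zpowers τ) := by
  apply dvd_invR_of_isAdmissible_lcm hm ht
  obtain ⟨h1, h2, h3⟩ := invR_isAdmissible hm ht
  set r := invR (Subgroup.zpowers τ)
  have hr0 : r ≠ 0 := ne_zero_of_dvd_ne_zero hm h1
  have hodd : Odd (r / part 2 r) := by
    rw [← Nat.not_even_iff_odd, even_iff_two_dvd]
    exact Nat.not_dvd_ordCompl Nat.prime_two hr0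
  have hr : r = part 2 r * (r / part 2 r) := (Nat.mul_div_cancel' (part_dvd 2 r)).symm
  obtain ⟨j₀, hj₀, hj₀'⟩ : ∃ j₀, (part 2 r).lcm (2 ^ i) = 2 ^ j₀ ∧ (2 ^ j₀ ∣ r ∨ j₀ = i) := by
    unfold part
    rcases le_total (r.factorization 2) i with h | h
    · exact ⟨i, Nat.lcm_eq_right (pow_dvd_pow 2 h), Or.inr rfl⟩
    · exact ⟨_, Nat.lcm_eq_left (pow_dvd_pow 2 h), Or.inl (part_dvd 2 r)⟩
  have hL : r.lcm (2 ^ i) ∣ 2 ^ j₀ * (r / part 2 r) := by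
    rw [← hj₀]
    refine Nat.lcm_dvd ?_ ((Nat.dvd_lcm_right _ _).mul_right _)
    conv_lhs => rw [hr]
    exact mul_dvd_mul_right (Nat.dvd_lcm_left _ _) _
  refine ⟨Nat.lcm_dvd h1 hpm, fun x hx hxL => ?_, fun j hj => ?_⟩
  · have h4 : x ∣ r / part 2 r :=
      ((Nat.coprime_two_right.2 hx).pow_right _).dvd_of_dvd_mul_left (hxL.trans hL)
    exact h2 x hx (h4.trans (Nat.div_dvd_of_dvd (part_dvd 2 r)))
  · have h4 : 2 ^ j ∣ 2 ^ j₀ :=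
      ((Nat.coprime_two_left.2 hodd).pow_left j).dvd_of_dvd_mul_right (hj.trans hL)
    rcases hj₀' with h5 | rfl
    · exact h3 j (h4.trans h5)
    · have h4' : (2 : ℤ) ^ j ∣ (2 : ℤ) ^ j₀ := by exact_mod_cast h4
      exact hpt.imp h4'.trans h4'.trans

/-- Passing to Hall subgroups commutes with reduction, so `o` depends only on the image of `T`
modulo `m_ν`. Hence `t ^ V ≡ 1` modulo `m_ν` implies `o ∣ V`. -/
lemma invO_eq (hm : m ≠ 0) (T : Subgroup (ZMod m)ˣ) :
    invO T = Nat.card (hallCompl (nuSet m (invR T)) (res (piPart (nuSet m (invR T)) m) T)) := by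
  have : NeZero m := ⟨hm⟩
  unfold invO
  set ν := nuSet m (invR T)
  by_cases h : piPart ν m ∣ m
  · rw [res, res, dif_pos h, dif_pos h, hallCompl_map]
  · exfalso
    apply h
    have h1 : piPart ν m ∣ piPart m.primeFactors m :=
      Finset.prod_dvd_prod_of_subset _ _ _ Finset.sdiff_subset
    exact h1.trans (Nat.prod_factorization_pow_eq_self hm).dvd

end

end Metacyclic

/-! ### Global consequences of the comparison. -/

/-- Two metacyclic presentations of a group with the same numerical invariants, where `Q` is the
part of the order of the kernel that is prime to `r`, and the second is expressed by the first. -/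
structure MetacyclicComparison {G : Type*} [Group G] (a b c d : G) (t t' l k r o Q : ℕ) : Prop where
  gen : MetacyclicGen a b t
  gen' : MetacyclicGen c d t'
  eq_mul : d = a ^ l * b ^ k
  order_eq : orderOf c = orderOf a
  index_left : (Subgroup.zpowers c).index = (Subgroup.zpowers a).index
  index_right : (Subgroup.zpowers d).index = (Subgroup.zpowers b).index
  r_dvd : r ∣ orderOf a
  odd_dvd : ∀ p i : ℕ, Odd p → p ^ i ∣ orderOf a → (p : ℤ) ^ i ∣ (t : ℤ) - 1 → p ^ i ∣ r
  two_dvd : ∀ i : ℕ, 2 ^ i ∣ orderOf a →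
    (2 : ℤ) ^ i ∣ (t : ℤ) - 1 ∨ (2 : ℤ) ^ i ∣ (t : ℤ) + 1 → 2 ^ i ∣ r
  Q_dvd : Q ∣ orderOf a
  Q_coprime : ∀ q : ℕ, q.Prime → q ∣ Q → ¬ q ∣ r
  o_dvd : ∀ V : ℕ, (Q : ℤ) ∣ (t : ℤ) ^ V - 1 → o ∣ V
  index_le : ∀ b' : G, MetacyclicGen a b' t →
    (Subgroup.zpowers b).index ≤ (Subgroup.zpowers b').index

namespace MetacyclicComparison

variable {G : Type*} [Group G] {a b c d : G} {t t' l k r o Q : ℕ}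

lemma prime_pow_dvd (h : MetacyclicComparison a b c d t t' l k r o Q) {p i : ℕ} (hp : p.Prime)
    (hpm : p ^ i ∣ orderOf a) (hpt : (p : ℤ) ^ i ∣ (t : ℤ) - 1) : p ^ i ∣ r := by
  rcases hp.eq_two_or_odd' with rfl | hodd
  · exact h.two_dvd i hpm (Or.inl (by exact_mod_cast hpt))
  · exact h.odd_dvd p i hodd hpm hpt

/-- A prime dividing both `m` and `t - 1` divides `r`, and `Q` is prime to `r`. -/
lemma isCoprime (h : MetacyclicComparison a b c d t t' l k r o Q) :
    IsCoprime (Q : ℤ) ((t : ℤ) - 1) := by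
  rw [Int.isCoprime_iff_gcd_eq_one]
  by_contra hne
  obtain ⟨q, hq, hqg⟩ := Nat.exists_prime_and_dvd hne
  have h1 : q ∣ Q := by
    have := (Int.natCast_dvd_natCast.2 hqg).trans (Int.gcd_dvd_left _ _)
    exact_mod_cast this
  have h2 : (q : ℤ) ∣ (t : ℤ) - 1 := (Int.natCast_dvd_natCast.2 hqg).trans (Int.gcd_dvd_right _ _)
  refine h.Q_coprime q hq h1 ?_
  have := h.prime_pow_dvd hq (i := 1) (by rw [pow_one]; exact h1.trans h.Q_dvd)
    (by rw [pow_one]; exact h2)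
  rwa [pow_one] at this

lemma agree (h : MetacyclicComparison a b c d t t' l k r o Q) {g : G} {w y : ℕ}
    (hw : g * a * g⁻¹ = a ^ w) (hy : g * c * g⁻¹ = c ^ y) : (Q : ℤ) ∣ (w : ℤ) - y :=
  h.isCoprime.dvd_of_dvd_mul_left
    ((Int.natCast_dvd_natCast.2 h.Q_dvd).trans (h.gen.agree h.gen' hw hy))

lemma Q_dvd_sub (h : MetacyclicComparison a b c d t t' l k r o Q) :
    (Q : ℤ) ∣ (t : ℤ) ^ k - t' := by
  have := h.agree (h.gen.conj_eq h.eq_mul) h.gen'.conj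
  exact_mod_cast this

lemma orderOf_dvd_mul_sub (h : MetacyclicComparison a b c d t t' l k r o Q) :
    (orderOf a : ℤ) ∣ ((t : ℤ) - 1) * ((t : ℤ) ^ k - t') := by
  have := h.gen.agree h.gen' (h.gen.conj_eq h.eq_mul) h.gen'.conj
  exact_mod_cast this

lemma exists_Q_dvd_sub (h : MetacyclicComparison a b c d t t' l k r o Q) :
    ∃ j : ℕ, (Q : ℤ) ∣ (t : ℤ) - (t' : ℤ) ^ j := by
  obtain ⟨i, j, hb⟩ := h.gen'.span b
  exact ⟨j, by exact_mod_cast h.agree h.gen.conj (h.gen'.conj_eq hb)⟩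

lemma o_dvd' (h : MetacyclicComparison a b c d t t' l k r o Q) {V : ℕ}
    (hV : (Q : ℤ) ∣ (t' : ℤ) ^ V - 1) : o ∣ V := by
  obtain ⟨j, hj⟩ := h.exists_Q_dvd_sub
  apply h.o_dvd
  have h1 : (Q : ℤ) ∣ (t : ℤ) ^ V - ((t' : ℤ) ^ j) ^ V := hj.trans (sub_dvd_pow_sub_pow _ _ _)
  have h2 : (Q : ℤ) ∣ ((t' : ℤ) ^ j) ^ V - 1 := by
    rw [← pow_mul, mul_comm, pow_mul]
    exact hV.trans (sub_one_dvd_pow_sub_one _ _)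
  have h3 := dvd_add h1 h2
  rwa [sub_add_sub_cancel] at h3

/-- `a` acts trivially on itself and by `t' ^ j` on `c`; compare modulo `Q`. -/
lemma o_dvd_of_eq (h : MetacyclicComparison a b c d t t' l k r o Q) {i j : ℕ}
    (ha : a = c ^ i * d ^ j) : o ∣ j := by
  have h1 := h.agree (g := a) (w := 1) (by group) (h.gen'.conj_eq ha)
  apply h.o_dvd'
  rw [← dvd_neg, neg_sub]
  exact_mod_cast h1

/-- Modulo `Q`, `t` and `t'` are powers of each other, with exponents `j` and `k`. So `t ^ (k * j -
1) ≡ 1` there, and `o` divides `k * j - 1`. -/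
lemma odd_of_even_o [Finite G] (h : MetacyclicComparison a b c d t t' l k r o Q) (ho : 2 ∣ o) : Odd k := by
  obtain ⟨j, h1⟩ := h.exists_Q_dvd_sub
  have h2 : (Q : ℤ) ∣ ((t : ℤ) ^ k) ^ j - (t' : ℤ) ^ j :=
    h.Q_dvd_sub.trans (sub_dvd_pow_sub_pow _ _ _)
  have h3 := dvd_sub h2 h1
  rw [sub_sub_sub_cancel_right, ← pow_mul] at h3
  rcases Nat.eq_zero_or_pos (k * j) with h0 | h0
  · rw [h0, pow_zero, ← dvd_neg, neg_sub] at h3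
    have := ho.trans (h.o_dvd 1 (by rwa [pow_one]))
    omega
  · obtain ⟨v, hv⟩ : ∃ v, k * j = v + 1 := ⟨k * j - 1, by omega⟩
    have hcop : IsCoprime (Q : ℤ) (t : ℤ) := by
      obtain ⟨w, hw⟩ : ∃ w, 0 < w ∧ b ^ w = 1 := ⟨orderOf b, orderOf_pos b, pow_orderOf_eq_one b⟩
      have h4 := h.gen.pow_conj_zpow w 1
      rw [hw.2, one_mul, inv_one, mul_one, one_mul, eq_comm, ← mul_inv_eq_one, ← zpow_sub,
        ← orderOf_dvd_iff_zpow_eq_one] at h4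
      have h5 := (Int.natCast_dvd_natCast.2 h.Q_dvd).trans h4
      obtain ⟨x, hx⟩ := h5
      obtain ⟨w', rfl⟩ : ∃ w', w = w' + 1 := ⟨w - 1, by omega⟩
      exact ⟨-x, (t : ℤ) ^ w', by rw [← pow_succ]; linarith⟩
    rw [hv, pow_succ] at h3
    have h5 : (Q : ℤ) ∣ ((t : ℤ) ^ v - 1) * t := by rwa [sub_mul, one_mul]
    have h6 := ho.trans (h.o_dvd v (hcop.dvd_of_dvd_mul_right h5))
    have h7 : Odd (k * j) := by rw [hv]; exact (even_iff_two_dvd.2 h6).add_one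
    exact (Nat.odd_mul.1 h7).1

end MetacyclicComparison

/-- Lifting the exponent at `2` for even `N`, where `t - 1` contributes exactly one factor `2`,
because `4 ∣ t + 1`. -/
lemma Int.two_pow_exact {t : ℤ} {ρ κ N : ℕ} (hρ : 2 ≤ ρ) (h1 : (2 : ℤ) ^ ρ ∣ t + 1)
    (h2 : ¬ (2 : ℤ) ^ (ρ + 1) ∣ t + 1) (hκ : κ ≠ 0) (h3 : 2 ^ κ ∣ N) (h4 : ¬ 2 ^ (κ + 1) ∣ N) :
    (2 : ℤ) ^ (ρ + κ) ∣ t ^ N - 1 ∧ ¬ (2 : ℤ) ^ (ρ + κ + 1) ∣ t ^ N - 1 := by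
  have h4t : (4 : ℤ) ∣ t + 1 := (pow_dvd_pow (2 : ℤ) hρ).trans h1
  have hodd : ¬ (2 : ℤ) ∣ t := by omega
  have e1 : emultiplicity (2 : ℤ) (t + 1) = ρ := emultiplicity_eq_coe.2 ⟨h1, h2⟩
  have e2 : emultiplicity (2 : ℤ) (t - 1) = (1 : ℕ) :=
    emultiplicity_eq_coe.2 ⟨by rw [pow_one]; omega, by rw [one_add_one_eq_two]; omega⟩
  have e3 : emultiplicity (2 : ℤ) (N : ℤ) = κ :=
    emultiplicity_eq_coe.2 ⟨by exact_mod_cast h3, by exact_mod_cast h4⟩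
  have hN : Even N := even_iff_two_dvd.2 ((dvd_pow_self 2 hκ).trans h3)
  have := Int.two_pow_sub_pow (x := t) (y := 1) (n := N) (by omega) hodd hN
  rw [one_pow, e1, e2, e3] at this
  have e4 : emultiplicity (2 : ℤ) (t ^ N - 1) = (ρ + κ : ℕ) := by
    have e5 : emultiplicity (2 : ℤ) (t ^ N - 1) + 1 = ((ρ + κ : ℕ) : ℕ∞) + 1 := by
      rw [this]; push_cast; ring
    exact (ENat.add_left_injective_of_ne_top ENat.one_ne_top) e5
  exact emultiplicity_eq_coe.1 e4

/-! ### Primes of `r` at which the action modulo `r_p` is trivial. -/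

namespace MetacyclicComparison

variable {G : Type*} [Group G] {a b c d : G} {t t' l k r o Q : ℕ}

lemma Q_dvd_ordCompl (h : MetacyclicComparison a b c d t t' l k r o Q) {p μ mq : ℕ}
    (hp : p.Prime) (hpr : p ∣ r) (hm : orderOf a = p ^ μ * mq) : Q ∣ mq := by
  have h1 : Q.Coprime (p ^ μ) := by
    refine Nat.Coprime.pow_right _ ((Nat.coprime_comm).1 ((Nat.Prime.coprime_iff_not_dvd hp).2 ?_))
    intro h2
    exact h.Q_coprime p hp h2 hpr
  exact h1.dvd_of_dvd_mul_left (hm ▸ h.Q_dvd)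

/-- The two actions agree modulo `p ^ g` when the action of `⟨b⟩` is trivial modulo `r_p`. -/
lemma pow_dvd_sub_of_trivial [Finite G] (h : MetacyclicComparison a b c d t t' l k r o Q)
    {p μ mq κ n' σ ρ ω g : ℕ} (hp : p.Prime) (hpr : p ∣ r)
    (hm : orderOf a = p ^ μ * mq) (hmq : ¬ p ∣ mq)
    (hn : (Subgroup.zpowers a).index = p ^ κ * n') (hn' : ¬ p ∣ n')
    (hs : p ^ σ ∣ (Subgroup.zpowers b).index)
    (hρ : ∀ i, p ^ i ∣ r → i ≤ ρ) (ho : p ^ ω ∣ o) (htr : (p : ℤ) ^ ρ ∣ (t : ℤ) - 1)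
    (htr' : (p : ℤ) ^ ρ ∣ (t' : ℤ) - 1) (hgμ : g ≤ μ) (hgω : g ≤ ω + ρ)
    (hg : g ≤ ρ ∨ g ≤ σ ∨ g + κ ≤ ρ + σ + ω) : (p : ℤ) ^ g ∣ (t : ℤ) ^ k - t' := by
  have hp' := Nat.prime_iff_prime_int.1 hp
  by_cases hgρ : g ≤ ρ
  · have h1 := (pow_dvd_pow (p : ℤ) hgρ)
    have h2 := (h1.trans htr).trans (sub_one_dvd_pow_sub_one _ k)
    have h3 := dvd_sub h2 (h1.trans htr')
    rwa [sub_sub_sub_cancel_right] at h3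
  have hω : ω ≠ 0 := by omega
  have hρ0 : ρ ≠ 0 := by
    have := hρ 1 (by rwa [pow_one])
    omega
  have hpo : p ∣ o := (dvd_pow_self p hω).trans ho
  obtain ⟨k₀, hk₀, -⟩ := h.gen.pow_index_eq
  obtain ⟨u, V, f, hV, hu, hf, hE⟩ := h.gen.exists_exponents h.gen' hp h.eq_mul hm hmq (by omega) hk₀
  -- Otherwise the action is trivial modulo `p ^ μ`, so `p ^ μ ∣ r` and `μ ≤ ρ`, against `ρ < g ≤
  -- μ`.
  have hpu : ¬ p ∣ u := by
    intro hpu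
    have h1 := hu ((dvd_pow_self _ hρ0).trans htr)
      (fun i j hij => hpo.trans (h.o_dvd_of_eq hij)) hpu
    have := hρ μ (h.prime_pow_dvd hp (hm ▸ dvd_mul_right _ _) h1)
    omega
  have hoV : p ^ ω ∣ V := ho.trans (h.o_dvd V
    ((Int.natCast_dvd_natCast.2 (h.Q_dvd_ordCompl hp hpr hm)).trans hV))
  have hz : (p : ℤ) ^ g ∣ (t : ℤ) ^ V - 1 :=
    (pow_dvd_pow _ (by omega)).trans (Int.pow_dvd_pow_sub_one hρ0 htr hoV)
  have hS := Int.geom_sum_modEq hz t'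
  set S := ∑ i ∈ Finset.range t', ((t : ℤ) ^ V) ^ i
  set s := (Subgroup.zpowers b).index
  -- In the last alternative, `n * (s * f) = s * V * (t' - 1)` is divisible by `s_p`, `o_p` and
  -- `r_p` together; dividing by `n_p` leaves `p ^ g`.
  have hsf : (p : ℤ) ^ g ∣ s * f := by
    have hs' : (p : ℤ) ^ σ ∣ s := by exact_mod_cast hs
    rcases hg with hg | hg | hg
    · omega
    · exact ((pow_dvd_pow _ hg).trans hs').mul_right f
    · rw [hn] at hf
      have hoV' : (p : ℤ) ^ ω ∣ V := by exact_mod_cast hoV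
      have h1 : (p : ℤ) ^ (g + κ) ∣ (p : ℤ) ^ σ * ((p : ℤ) ^ ω * (p : ℤ) ^ ρ) := by
        rw [← pow_add, ← pow_add]
        exact pow_dvd_pow _ (by omega)
      have h2 := h1.trans (mul_dvd_mul hs' (mul_dvd_mul hoV' htr'))
      rw [hf, pow_add] at h2
      push_cast at h2
      have h3 : (p : ℤ) ^ g ∣ n' * (s * f) := by
        have hpκ : (p : ℤ) ^ κ ≠ 0 := pow_ne_zero _ (by exact_mod_cast hp.ne_zero)
        refine Int.dvd_of_mul_dvd_mul_left hpκ ?_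
        have e : (p : ℤ) ^ κ * (n' * (s * f)) = s * ((p : ℤ) ^ κ * n' * f) := by ring
        rw [e, mul_comm]
        exact h2
      refine IsCoprime.dvd_of_dvd_mul_left (IsCoprime.pow_left ?_) h3
      rw [Prime.coprime_iff_not_dvd hp']
      exact_mod_cast hn'
  have hfin : (p : ℤ) ^ g ∣ u * ((t : ℤ) ^ k - t') := by
    have h1 := (pow_dvd_pow (p : ℤ) hgμ).trans hE
    have h2 := dvd_add (dvd_add (dvd_add h1 (hz.mul_left l)) (hS.mul_left u)) (hsf.mul_left k₀)
    have e : (u : ℤ) * (t : ℤ) ^ k + l * (1 - (t : ℤ) ^ V) - u * S - s * k₀ * f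
        + l * ((t : ℤ) ^ V - 1) + u * (S - t') + k₀ * (s * f) = u * ((t : ℤ) ^ k - t') := by
      ring
    rwa [e] at h2
  refine IsCoprime.dvd_of_dvd_mul_left (IsCoprime.pow_left ?_) hfin
  rw [Prime.coprime_iff_not_dvd hp']
  exact_mod_cast hpu

end MetacyclicComparison

/-! ### The prime two with action `-1` modulo `r_2`. -/

lemma Int.geom_sum_odd_modEq {M z : ℤ} (hz : M ∣ z ^ 2 - 1) (p : ℕ) :
    M ∣ (∑ i ∈ Finset.range (2 * p + 1), z ^ i) - (p * (1 + z) + 1) := by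
  induction p with
  | zero => simp
  | succ p ih =>
    rw [show 2 * (p + 1) + 1 = 2 * p + 1 + 1 + 1 by ring, Finset.sum_range_succ,
      Finset.sum_range_succ]
    have h1 : M ∣ z ^ (2 * p) - 1 := by
      rw [pow_mul]; exact hz.trans (sub_one_dvd_pow_sub_one _ _)
    have h2 := dvd_add ih (h1.mul_right (z + z ^ 2))
    have h3 := dvd_add h2 hz
    refine h3.trans (dvd_of_eq ?_)
    push_cast
    ring

/-- If `t = -1 + 2 ^ ρ * odd`, the geometric sum of `t` of length `2 ^ κ * odd`. -/
lemma Int.two_pow_exact_geom_sum {t : ℤ} {ρ κ N : ℕ} (hρ : 2 ≤ ρ) (h1 : (2 : ℤ) ^ ρ ∣ t + 1)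
    (h2 : ¬ (2 : ℤ) ^ (ρ + 1) ∣ t + 1) (hκ : κ ≠ 0) (h3 : 2 ^ κ ∣ N) (h4 : ¬ 2 ^ (κ + 1) ∣ N) :
    ∃ x : ℤ, Odd x ∧ ∑ i ∈ Finset.range N, t ^ i = 2 ^ (ρ + κ - 1) * x := by
  obtain ⟨h5, h6⟩ := Int.two_pow_exact hρ h1 h2 hκ h3 h4
  have h4t : (4 : ℤ) ∣ t + 1 := (pow_dvd_pow (2 : ℤ) hρ).trans h1
  obtain ⟨v, hv⟩ : ∃ v, t - 1 = 2 * v := ⟨(t - 1) / 2, by omega⟩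
  have hvo : Odd v := by rw [Int.odd_iff]; omega
  obtain ⟨j, hj⟩ : ∃ j, ρ + κ = j + 1 := ⟨ρ + κ - 1, by omega⟩
  rw [show ρ + κ - 1 = j by omega]
  rw [hj, ← mul_geom_sum, hv, mul_assoc, pow_succ, mul_comm] at h5
  rw [hj, ← mul_geom_sum, hv, mul_assoc, pow_succ, mul_comm] at h6
  have h7 := Int.dvd_of_mul_dvd_mul_left two_ne_zero h5
  have hcop : IsCoprime ((2 : ℤ) ^ j) v := by
    refine IsCoprime.pow_left ?_
    rw [Prime.coprime_iff_not_dvd Int.prime_two]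
    intro h; exact (Int.not_even_iff_odd.2 hvo) (even_iff_two_dvd.2 h)
  obtain ⟨x, hx⟩ := hcop.dvd_of_dvd_mul_left h7
  refine ⟨x, ?_, hx⟩
  rw [← Int.not_even_iff_odd]
  rintro ⟨y, rfl⟩
  apply h6
  rw [hx]
  refine mul_dvd_mul_left 2 ⟨v * y, ?_⟩
  rw [pow_succ]; ring

namespace MetacyclicGen

variable {G : Type*} [Group G] [Finite G] {a b : G} {t : ℕ}

/-- Supplies the competitors `a ^ x * b` for `b` against which minimality of `[G : B]` is tested. -/
lemma mul_right (h : MetacyclicGen a b t) (x : ℕ) : MetacyclicGen a (a ^ x * b) t := by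
  have hconj : a ^ x * b * a * (a ^ x * b)⁻¹ = a ^ t := by
    have := h.conj_eq (g := a ^ x * b) (l := x) (k := 1) (by rw [pow_one])
    rwa [pow_one] at this
  refine ⟨hconj, fun g => ?_⟩
  obtain ⟨i, j, rfl⟩ := h.span g
  have e := mul_pow_of_conj h.conj x j
  have hmem : a ^ i * (a ^ (x * ∑ i ∈ Finset.range j, t ^ i))⁻¹ ∈ Submonoid.powers a := by
    rw [mem_powers_iff_mem_zpowers]
    exact mul_mem (Subgroup.pow_mem _ (Subgroup.mem_zpowers a) _)
      (inv_mem (Subgroup.pow_mem _ (Subgroup.mem_zpowers a) _))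
  obtain ⟨i', hi'⟩ := hmem
  refine ⟨i', j, ?_⟩
  dsimp only at hi'
  rw [hi', e]
  group

lemma orderOf_dvd_pow_index_sub_one (h : MetacyclicGen a b t) :
    (orderOf a : ℤ) ∣ (t : ℤ) ^ (Subgroup.zpowers a).index - 1 := by
  obtain ⟨k₀, hk₀, -⟩ := h.pow_index_eq
  have h1 := h.pow_conj_zpow (Subgroup.zpowers a).index 1
  rw [hk₀, zpow_one, one_mul, ((Commute.refl a).pow_left _).eq, mul_inv_cancel_right, eq_comm,
    ← mul_inv_eq_one, ← zpow_sub_one, ← orderOf_dvd_iff_zpow_eq_one] at h1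
  exact h1

/-- `b ^ n` is a power of `a`, so conjugation by `b` raises it to the power `t`; but it also
commutes with `b`. -/
lemma orderOf_pow_index_dvd (h : MetacyclicGen a b t) :
    (orderOf (b ^ (Subgroup.zpowers a).index) : ℤ) ∣ (t : ℤ) - 1 := by
  obtain ⟨k₀, hk₀, -⟩ := h.pow_index_eq
  set n := (Subgroup.zpowers a).index
  have h1 : b * b ^ n * b⁻¹ = (b ^ n) ^ t := by
    conv_lhs => rw [hk₀]
    rw [← conj_pow, h.conj, ← pow_mul, mul_comm, pow_mul, ← hk₀]
  rw [((Commute.refl b).pow_right n).eq, mul_inv_cancel_right] at h1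
  rw [orderOf_dvd_iff_zpow_eq_one, zpow_sub_one, mul_inv_eq_one, zpow_natCast]
  exact h1.symm

end MetacyclicGen

namespace MetacyclicComparison

variable {G : Type*} [Group G] {a b c d : G} {t t' l k r o Q : ℕ}

lemma two_pow_dvd_sub (h : MetacyclicComparison a b c d t t' l k r o Q) {μ : ℕ}
    (hμ : 2 ^ (μ + 1) ∣ orderOf a) (ht : (4 : ℤ) ∣ (t : ℤ) + 1) :
    (2 : ℤ) ^ μ ∣ (t : ℤ) ^ k - t' := by
  obtain ⟨v, hv⟩ : ∃ v, (t : ℤ) - 1 = 2 * v := ⟨((t : ℤ) - 1) / 2, by omega⟩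
  have h1 : (2 : ℤ) ^ (μ + 1) ∣ orderOf a := by exact_mod_cast hμ
  have h2 := h1.trans h.orderOf_dvd_mul_sub
  rw [hv, pow_succ, mul_comm, mul_assoc] at h2
  have h7 := Int.dvd_of_mul_dvd_mul_left two_ne_zero h2
  refine IsCoprime.dvd_of_dvd_mul_left (IsCoprime.pow_left ?_) h7
  rw [Prime.coprime_iff_not_dvd Int.prime_two]
  omega

/-- Excludes `s_2 = m_2 = n_2 r_2`. There `b ^ n` has odd order, while for `b' = a ^ mq * b` the
geometric sum has 2-adic valuation one below that of `m`. So `b' ^ n` is `b ^ n` times a commuting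
involution, and `[G : ⟨b'⟩]` is half of `[G : ⟨b⟩]`. -/
lemma lt_of_index_le [Finite G] (h : MetacyclicComparison a b c d t t' l k r o Q) {ρ κ mq n' s' : ℕ}
    (hρ : 2 ≤ ρ) (hκ : κ ≠ 0) (h1 : (2 : ℤ) ^ ρ ∣ (t : ℤ) + 1)
    (h2 : ¬ (2 : ℤ) ^ (ρ + 1) ∣ (t : ℤ) + 1) (hm : orderOf a = 2 ^ (ρ + κ) * mq) (hmq : ¬ 2 ∣ mq)
    (hn : (Subgroup.zpowers a).index = 2 ^ κ * n') (hn' : ¬ 2 ∣ n')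
    (hs : (Subgroup.zpowers b).index = 2 ^ (ρ + κ) * s') : False := by
  set n := (Subgroup.zpowers a).index with hndef
  have hg := h.gen.mul_right mq
  have e := mul_pow_of_conj h.gen.conj mq n
  obtain ⟨x, hx, hG⟩ := Int.two_pow_exact_geom_sum hρ h1 h2 hκ (N := n) (hn ▸ dvd_mul_right _ _)
    (by
      rw [hn, pow_succ]
      intro h3
      exact hn' (Nat.dvd_of_mul_dvd_mul_left (by positivity) h3))
  obtain ⟨j, hj⟩ : ∃ j, ρ + κ = j + 1 := ⟨ρ + κ - 1, by omega⟩
  rw [show ρ + κ - 1 = j by omega] at hG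
  rw [hj] at hm hs
  have hmq0 : mq ≠ 0 := by rintro rfl; simp at hmq
  have ho1 : orderOf (a ^ (mq * ∑ i ∈ Finset.range n, t ^ i)) = 2 := by
    refine orderOf_eq_prime ?_ ?_
    · rw [← pow_mul, ← zpow_natCast, ← orderOf_dvd_iff_zpow_eq_one, hm]
      push_cast
      rw [hG]
      exact ⟨x, by ring⟩
    · rw [← zpow_natCast, Ne, ← orderOf_dvd_iff_zpow_eq_one, hm]
      push_cast
      rw [hG]
      intro h3
      have h4 : (2 : ℤ) ^ j * mq * 2 ∣ (2 : ℤ) ^ j * mq * x := by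
        refine (dvd_of_eq ?_).trans (h3.trans (dvd_of_eq ?_)) <;> ring
      have h5 := Int.dvd_of_mul_dvd_mul_left (by positivity) h4
      exact (Int.not_even_iff_odd.2 hx) (even_iff_two_dvd.2 h5)
  have hio := h.gen.index_mul_orderOf
  rw [hs, hm, mul_assoc] at hio
  have hq : s' * orderOf (b ^ n) = mq := Nat.eq_of_mul_eq_mul_left (by positivity) hio
  have hqo : ¬ 2 ∣ orderOf (b ^ n) := fun h3 => hmq (hq ▸ h3.mul_left s')
  have hcomm : Commute (a ^ (mq * ∑ i ∈ Finset.range n, t ^ i)) (b ^ n) := by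
    obtain ⟨k₀, hk₀, -⟩ := h.gen.pow_index_eq
    rw [hk₀]
    exact Commute.pow_pow_self _ _ _
  have ho2 : orderOf ((a ^ mq * b) ^ n) = 2 * orderOf (b ^ n) := by
    rw [e, hcomm.orderOf_mul_eq_mul_orderOf_of_coprime, ho1]
    rw [ho1]
    exact (Nat.Prime.coprime_iff_not_dvd Nat.prime_two).2 hqo
  have hio' := hg.index_mul_orderOf
  rw [← hndef, ho2, ← h.gen.index_mul_orderOf] at hio'
  have hle := h.index_le _ hg
  have hpos : 0 < orderOf (b ^ n) := orderOf_pos _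
  have hpos' : 0 < (Subgroup.zpowers b).index :=
    Nat.pos_of_ne_zero Subgroup.index_ne_zero_of_finite
  have h5 : (Subgroup.zpowers (a ^ mq * b)).index * 2 = (Subgroup.zpowers b).index := by
    apply Nat.eq_of_mul_eq_mul_right hpos
    rw [← hio']; ring
  omega

/-- In `d ^ n = a ^ (l * sum + s * k₀ * k)` the second summand has valuation exactly `ρ + κ - 1`,
and so has the first if `l` is odd. Their sum would then make `d ^ n` of odd order, whereas `[G :
⟨d⟩] = [G : ⟨b⟩]` forces an even order. -/
lemma even_of_index [Finite G] (h : MetacyclicComparison a b c d t t' l k r o Q) {ρ κ mq n' s' k₀ : ℕ}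
    (hρ : 2 ≤ ρ) (hκ : κ ≠ 0) (h1 : (2 : ℤ) ^ ρ ∣ (t : ℤ) + 1)
    (h2 : ¬ (2 : ℤ) ^ (ρ + 1) ∣ (t : ℤ) + 1) (hk : Odd k)
    (hm : orderOf a = 2 ^ (ρ + κ) * mq) (hmq : ¬ 2 ∣ mq)
    (hn : (Subgroup.zpowers a).index = 2 ^ κ * n') (hn' : ¬ 2 ∣ n')
    (hs : (Subgroup.zpowers b).index = 2 ^ (ρ + κ - 1) * s') (hs' : ¬ 2 ∣ s')
    (hk₀ : b ^ (Subgroup.zpowers a).index = a ^ ((Subgroup.zpowers b).index * k₀))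
    (hk₀' : Odd k₀) : Even l := by
  rw [← Nat.not_odd_iff_even]
  intro hl
  set n := (Subgroup.zpowers a).index with hndef
  have hnd : ¬ 2 ^ (κ + 1) ∣ n := by
    rw [hn, pow_succ]
    intro h3
    exact hn' (Nat.dvd_of_mul_dvd_mul_left (by positivity) h3)
  have h1' : (2 : ℤ) ^ ρ ∣ (t : ℤ) ^ k + 1 :=
    h1.trans (by simpa using hk.add_dvd_pow_add_pow (t : ℤ) 1)
  have h2' : ¬ (2 : ℤ) ^ (ρ + 1) ∣ (t : ℤ) ^ k + 1 := by
    intro h3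
    have e1 : (-(t : ℤ) - 1) * ∑ i ∈ Finset.range k, (-(t : ℤ)) ^ i = -((t : ℤ) ^ k + 1) := by
      rw [mul_geom_sum, hk.neg_pow]; ring
    have h4t : (4 : ℤ) ∣ (t : ℤ) + 1 := (pow_dvd_pow (2 : ℤ) hρ).trans h1
    have h4 := Int.geom_sum_modEq (x := -(t : ℤ)) (m := 2) (by omega) k
    have h5 : (2 : ℤ) ^ (ρ + 1) ∣ -(t : ℤ) - 1 := by
      refine IsCoprime.dvd_of_dvd_mul_right (IsCoprime.pow_left ?_) (e1 ▸ h3.neg_right)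
      rw [Prime.coprime_iff_not_dvd Int.prime_two]
      intro h5
      have h6 := (dvd_sub_right h5).1 h4
      rw [Nat.odd_iff] at hk
      omega
    exact h2 ((dvd_neg.2 h5).trans (dvd_of_eq (by ring)))
  obtain ⟨x, hx, hG⟩ := Int.two_pow_exact_geom_sum hρ h1' h2' hκ (N := n)
    (hn ▸ dvd_mul_right _ _) hnd
  obtain ⟨j, hj⟩ : ∃ j, ρ + κ = j + 1 := ⟨ρ + κ - 1, by omega⟩
  rw [show ρ + κ - 1 = j by omega] at hG hs
  rw [hj] at hm
  have e : d ^ n = a ^ (l * ∑ i ∈ Finset.range n, (t ^ k) ^ i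
      + (Subgroup.zpowers b).index * k₀ * k) := by
    rw [h.eq_mul, mul_pow_of_conj (h.gen.pow_conj k), ← pow_mul b, mul_comm k, pow_mul b, hk₀,
      ← pow_mul, ← pow_add]
  have hdvd : d ^ (n * mq) = 1 := by
    rw [pow_mul, e, ← pow_mul, ← zpow_natCast, ← orderOf_dvd_iff_zpow_eq_one, hm, hs]
    push_cast
    rw [hG]
    have hev : Even (l * x + s' * k₀ * k) := by
      have hl' : Odd (l : ℤ) := by exact_mod_cast hl
      have hs2 : Odd (s' : ℤ) := by
        have : Odd s' := by rwa [← Nat.not_even_iff_odd, even_iff_two_dvd]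
        exact_mod_cast this
      have hk2 : Odd (k : ℤ) := by exact_mod_cast hk
      have hk3 : Odd (k₀ : ℤ) := by exact_mod_cast hk₀'
      exact (hl'.mul hx).add_odd ((hs2.mul hk3).mul hk2)
    obtain ⟨v, hv⟩ := hev
    refine ⟨v, ?_⟩
    linear_combination ((2 : ℤ) ^ j * mq) * hv
  rw [pow_mul] at hdvd
  have h6 := orderOf_dvd_of_pow_eq_one hdvd
  have hio := h.gen'.index_mul_orderOf
  rw [h.index_left, h.index_right, h.order_eq, hs, hm, ← hndef, pow_succ, mul_assoc, mul_assoc] at hio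
  have h7 : s' * orderOf (d ^ n) = 2 * mq := Nat.eq_of_mul_eq_mul_left (by positivity) hio
  have h8 : 2 ∣ orderOf (d ^ n) :=
    (((Nat.Prime.coprime_iff_not_dvd Nat.prime_two).2 hs')).dvd_of_dvd_mul_left
      (h7 ▸ dvd_mul_right _ _)
  exact hmq (h8.trans h6)

end MetacyclicComparison

namespace MetacyclicComparison

variable {G : Type*} [Group G] [Finite G] {a b c d : G} {t t' l k r o Q : ℕ}

set_option maxHeartbeats 400000 in
/-- The two actions agree modulo the full power of two, in the last case of the definition of
`m'_2`. -/
lemma two_pow_dvd_sub_of_neg (h : MetacyclicComparison a b c d t t' l k r o Q)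
    {μ mq κ n' σ s' ρ ω : ℕ} (h2r : 2 ∣ r)
    (hm : orderOf a = 2 ^ μ * mq) (hmq : ¬ 2 ∣ mq)
    (hn : (Subgroup.zpowers a).index = 2 ^ κ * n') (hn' : ¬ 2 ∣ n')
    (hs : (Subgroup.zpowers b).index = 2 ^ σ * s') (hs' : ¬ 2 ∣ s')
    (hr : ∀ i, 2 ^ i ∣ r → i ≤ ρ) (hρ : 2 ≤ ρ) (h1 : (2 : ℤ) ^ ρ ∣ (t : ℤ) + 1)
    (h1' : (2 : ℤ) ^ ρ ∣ (t' : ℤ) + 1) (ho : 2 ^ ω ∣ o) (hω : 2 ≤ ω) (hμ : ρ < μ)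
    (hcond : ω < κ → σ ≤ κ + ρ ∧ ¬ (σ + 1 = μ ∧ μ < κ + ρ)) :
    (2 : ℤ) ^ μ ∣ (t : ℤ) ^ k - t' := by
  have h4t : (4 : ℤ) ∣ (t : ℤ) + 1 := (pow_dvd_pow (2 : ℤ) hρ).trans h1
  have h4t' : (4 : ℤ) ∣ (t' : ℤ) + 1 := (pow_dvd_pow (2 : ℤ) hρ).trans h1'
  have hma : 2 ^ μ ∣ orderOf a := hm ▸ dvd_mul_right _ _
  have h2 : ¬ (2 : ℤ) ^ (ρ + 1) ∣ (t : ℤ) + 1 := by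
    intro h3
    have := hr _ (h.two_dvd _ ((pow_dvd_pow 2 hμ).trans hma) (Or.inr h3))
    omega
  have hk : Odd k := h.odd_of_even_o ((dvd_pow_self 2 (by omega)).trans ho)
  obtain ⟨ν, rfl⟩ : ∃ ν, μ = ν + 1 := ⟨μ - 1, by omega⟩
  obtain ⟨η, hη⟩ := h.two_pow_dvd_sub hma h4t
  have hQm : (Q : ℤ) ∣ orderOf a := by exact_mod_cast h.Q_dvd
  have hκ : 2 ≤ κ := by
    have h3 := ho.trans (h.o_dvd _ (hQm.trans h.gen.orderOf_dvd_pow_index_sub_one))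
    have h4 : 2 ^ ω ∣ 2 ^ κ := by
      rw [hn] at h3
      exact (Nat.Coprime.pow_left _ ((Nat.Prime.coprime_iff_not_dvd Nat.prime_two).2 hn')).dvd_of_dvd_mul_right h3
    have := (Nat.pow_dvd_pow_iff_le_right (by norm_num)).1 h4
    omega
  have hnd : ¬ 2 ^ (κ + 1) ∣ (Subgroup.zpowers a).index := by
    rw [hn, pow_succ]
    intro h3
    exact hn' (Nat.dvd_of_mul_dvd_mul_left (by positivity) h3)
  -- `m` divides `t ^ n - 1`, whose 2-adic valuation is exactly `ρ + κ`.
  have hμκ : ν + 1 ≤ ρ + κ := by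
    by_contra hlt
    have h3 := (Int.two_pow_exact hρ h1 h2 (by omega) (hn ▸ dvd_mul_right _ _) hnd).2
    apply h3
    refine Dvd.dvd.trans ?_ h.gen.orderOf_dvd_pow_index_sub_one
    exact (pow_dvd_pow (2 : ℤ) (by omega)).trans
      (by exact_mod_cast hma : (2 : ℤ) ^ (ν + 1) ∣ orderOf a)
  obtain ⟨k₀, hk₀, hk₀q⟩ := h.gen.pow_index_eq
  have hio := h.gen.index_mul_orderOf
  have hqt := h.gen.orderOf_pow_index_dvd
  obtain ⟨u, V, f, hV, hu, hf, hE⟩ :=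
    h.gen.exists_exponents h.gen' Nat.prime_two h.eq_mul hm hmq (by omega) hk₀
  set q := orderOf (b ^ (Subgroup.zpowers a).index)
  -- `s * q = m`, and `q` divides `t - 1`, which is not divisible by `4`; so `s_2` is `m_2` or `m_2
  -- / 2`.
  have hσ : (σ = ν + 1 ∨ σ = ν ∧ 2 ∣ q) := by
    rw [hs, hm] at hio
    have hq4 : ¬ 4 ∣ q := by
      intro h3
      have : (4 : ℤ) ∣ (t : ℤ) - 1 := (by exact_mod_cast h3 : (4 : ℤ) ∣ q).trans hqt
      omega
    have hcop : ∀ i, Nat.Coprime (2 ^ i) mq := fun i =>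
      Nat.Coprime.pow_left i ((Nat.Prime.coprime_iff_not_dvd Nat.prime_two).2 hmq)
    have hcop' : ∀ i, Nat.Coprime (2 ^ i) s' := fun i =>
      Nat.Coprime.pow_left i ((Nat.Prime.coprime_iff_not_dvd Nat.prime_two).2 hs')
    have hσle : σ ≤ ν + 1 := by
      have h3 : 2 ^ σ ∣ 2 ^ (ν + 1) * mq := by
        rw [← hio, mul_assoc]; exact dvd_mul_right _ _
      exact (Nat.pow_dvd_pow_iff_le_right (by norm_num)).1 ((hcop σ).dvd_of_dvd_mul_right h3)
    obtain ⟨j, hj⟩ := Nat.exists_eq_add_of_le hσle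
    rw [hj, pow_add, mul_assoc, mul_assoc] at hio
    have h4 : s' * q = 2 ^ j * mq := Nat.eq_of_mul_eq_mul_left (by positivity) hio
    have h5 : 2 ^ j ∣ q := (hcop' j).dvd_of_dvd_mul_left (h4 ▸ dvd_mul_right _ _)
    have hj2 : j < 2 := by
      by_contra hj2
      exact hq4 ((pow_dvd_pow 2 (by omega : 2 ≤ j)).trans h5)
    interval_cases j
    · left; omega
    · right; exact ⟨by omega, by simpa using h5⟩
  have hu2 : Odd (u : ℤ) := by
    have h2u : ¬ 2 ∣ u := by
      intro h2u
      have h3 := hu (by push_cast; omega)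
        (fun i j hij => ((dvd_pow_self 2 (by omega)).trans ho).trans (h.o_dvd_of_eq hij)) h2u
      have : (4 : ℤ) ∣ (t : ℤ) - 1 := (pow_dvd_pow (2 : ℤ) (by omega : 2 ≤ ν + 1)).trans h3
      omega
    have : Odd u := by rwa [← Nat.not_even_iff_odd, even_iff_two_dvd]
    exact_mod_cast this
  have hoV : 2 ^ ω ∣ V := ho.trans (h.o_dvd V
    ((Int.natCast_dvd_natCast.2 (h.Q_dvd_ordCompl Nat.prime_two h2r hm)).trans hV))
  push_cast at hE
  set s := (Subgroup.zpowers b).index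
  set S := ∑ i ∈ Finset.range t', ((t : ℤ) ^ V) ^ i
  obtain ⟨v, hv⟩ : ∃ v, (t' : ℤ) - 1 = 2 * v := ⟨((t' : ℤ) - 1) / 2, by omega⟩
  have hvo : Odd v := by rw [Int.odd_iff]; omega
  have hcopZ : ∀ (i : ℕ) (x : ℤ), Odd x → IsCoprime ((2 : ℤ) ^ i) x := fun i x hx => by
    refine IsCoprime.pow_left ?_
    rw [Prime.coprime_iff_not_dvd Int.prime_two]
    intro h3; exact (Int.not_even_iff_odd.2 hx) (even_iff_two_dvd.2 h3)
  have hσs : (2 : ℤ) ^ σ ∣ s := by rw [hs]; push_cast; exact dvd_mul_right _ _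
  obtain ⟨κ', rfl⟩ : ∃ κ', κ = κ' + 1 := ⟨κ - 1, by omega⟩
  rw [hv, hn] at hf
  push_cast at hf
  -- From `n * f = V * (t' - 1)`, where `t' - 1` is exactly once even: if `f` is even then `n_2 ∣ V`
  -- and `t ^ V ≡ 1` modulo `m_2`; if `f` is odd then `V` has valuation exactly `κ - 1`, so `o_2 <
  -- n_2` and the side condition applies.
  rcases Int.even_or_odd f with hfe | hfo
  · have hκV : 2 ^ (κ' + 1) ∣ V := by
      obtain ⟨f', rfl⟩ := hfe
      have h3 : (2 : ℤ) ^ (κ' + 1) ∣ V * v := by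
        refine ⟨n' * f', ?_⟩
        linarith
      have h4 := (hcopZ _ v hvo).dvd_of_dvd_mul_right h3
      exact_mod_cast h4
    have hz : (2 : ℤ) ^ (ν + 1) ∣ (t : ℤ) ^ V - 1 := by
      have h3 : (2 : ℤ) ^ (ρ + (κ' + 1)) ∣ (t : ℤ) ^ (2 ^ (κ' + 1)) - 1 :=
        (Int.two_pow_exact hρ h1 h2 (by omega) dvd_rfl
          (fun h4 => by
            have := (Nat.pow_dvd_pow_iff_le_right (by norm_num)).1 h4
            omega)).1
      obtain ⟨V', rfl⟩ := hκV
      rw [pow_mul]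
      exact (pow_dvd_pow (2 : ℤ) hμκ).trans (h3.trans (sub_one_dvd_pow_sub_one _ _))
    have hS := Int.geom_sum_modEq hz t'
    have hsf : (2 : ℤ) ^ (ν + 1) ∣ s * f := by
      have : (2 : ℤ) ^ ν ∣ s := (pow_dvd_pow (2 : ℤ) (by omega)).trans hσs
      rw [pow_succ]
      exact mul_dvd_mul this (even_iff_two_dvd.1 hfe)
    have h2' := dvd_add (dvd_add (dvd_add hE (hz.mul_left l)) (hS.mul_left u)) (hsf.mul_left k₀)
    have e : (u : ℤ) * (t : ℤ) ^ k + l * (1 - (t : ℤ) ^ V) - u * S - s * k₀ * f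
        + l * ((t : ℤ) ^ V - 1) + u * (S - t') + k₀ * (s * f) = u * ((t : ℤ) ^ k - t') := by
      ring
    rw [e] at h2'
    exact (hcopZ _ _ hu2).dvd_of_dvd_mul_left h2'
  · have hn2 : Odd (n' : ℤ) := by
      have : Odd n' := by rwa [← Nat.not_even_iff_odd, even_iff_two_dvd]
      exact_mod_cast this
    have hVv : (V : ℤ) * v = 2 ^ κ' * (n' * f) := by
      rw [pow_succ] at hf
      linarith
    have hκV : 2 ^ κ' ∣ V := by
      have := (hcopZ κ' v hvo).dvd_of_dvd_mul_right (Dvd.intro _ hVv.symm)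
      exact_mod_cast this
    have hκV' : ¬ 2 ^ (κ' + 1) ∣ V := by
      intro h3
      have h4 : (2 : ℤ) ^ (κ' + 1) ∣ 2 ^ κ' * (n' * f) := by
        rw [← hVv]
        exact (by exact_mod_cast h3 : (2 : ℤ) ^ (κ' + 1) ∣ V).mul_right _
      rw [pow_succ] at h4
      have h5 := Int.dvd_of_mul_dvd_mul_left (by positivity) h4
      exact (Int.not_even_iff_odd.2 (hn2.mul hfo)) (even_iff_two_dvd.2 h5)
    have hωκ : ω < κ' + 1 := by
      by_contra hlt
      exact hκV' ((pow_dvd_pow 2 (by omega)).trans hoV)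
    obtain ⟨hz1, hz2⟩ := Int.two_pow_exact hρ h1 h2 (by omega) hκV hκV'
    have hc := hcond hωκ
    obtain ⟨δ, hδ⟩ : (2 : ℤ) ^ ν ∣ (t : ℤ) ^ V - 1 :=
      (pow_dvd_pow (2 : ℤ) (by omega)).trans hz1
    have hδe : ν + 1 < ρ + (κ' + 1) → Even δ := by
      intro hlt
      have h3 : (2 : ℤ) ^ (ν + 1) ∣ (t : ℤ) ^ V - 1 :=
        (pow_dvd_pow (2 : ℤ) (by omega)).trans hz1
      rw [hδ, pow_succ] at h3
      exact even_iff_two_dvd.2 (Int.dvd_of_mul_dvd_mul_left (by positivity) h3)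
    have hδo : ν + 1 = ρ + (κ' + 1) → Odd δ := by
      intro heq
      rw [← Int.not_even_iff_odd]
      rintro ⟨x, rfl⟩
      apply hz2
      rw [hδ, show ρ + κ' + 1 = ν + 1 by omega, pow_succ]
      exact ⟨x, by ring⟩
    have hS : (2 : ℤ) ^ (ν + 1) ∣ S - (v * (1 + (t : ℤ) ^ V) + 1) := by
      have hsq : (2 : ℤ) ^ (ν + 1) ∣ ((t : ℤ) ^ V) ^ 2 - 1 := by
        have e : ((t : ℤ) ^ V) ^ 2 - 1 = ((t : ℤ) ^ V - 1) * (((t : ℤ) ^ V - 1) + 2) := by ring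
        rw [e, hδ, pow_succ]
        refine mul_dvd_mul (dvd_mul_right _ _) (dvd_add (Dvd.dvd.mul_right ?_ _) dvd_rfl)
        exact dvd_pow_self 2 (by omega)
      obtain ⟨w, hw⟩ : ∃ w : ℕ, t' = 2 * w + 1 := ⟨t' / 2, by omega⟩
      have hvw : v = w := by omega
      have := Int.geom_sum_odd_modEq hsq w
      rw [← hw] at this
      rwa [hvw]
    -- Write `t ^ V = 1 + 2 ^ ν * δ` and `t ^ k - t' = 2 ^ ν * η`. Dividing the basic congruence by
    -- `2 ^ ν` leaves a parity relation for `η`.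
    have key : Even (u * η - l * δ - u * v * δ - (s' * 2 ^ (σ - ν)) * k₀ * f) := by
      have h3 := dvd_add hE (hS.mul_left u)
      have hsν : (s : ℤ) = 2 ^ ν * (s' * 2 ^ (σ - ν)) := by
        rw [hs]; push_cast
        obtain ⟨j, rfl⟩ : ∃ j, σ = ν + j := ⟨σ - ν, by omega⟩
        rw [Nat.add_sub_cancel_left, pow_add]; ring
      have e : (u : ℤ) * (t : ℤ) ^ k + l * (1 - (t : ℤ) ^ V) - u * S - s * k₀ * f
          + u * (S - (v * (1 + (t : ℤ) ^ V) + 1))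
          = 2 ^ ν * (u * η - l * δ - u * v * δ - (s' * 2 ^ (σ - ν)) * k₀ * f) := by
        have e1 : (t : ℤ) ^ V = 1 + 2 ^ ν * δ := by linarith
        have e2 : (t : ℤ) ^ k = 2 * v + 1 + 2 ^ ν * η := by linarith
        rw [e1, e2, hsν]; ring
      rw [e, pow_succ] at h3
      exact even_iff_two_dvd.2 (Int.dvd_of_mul_dvd_mul_left (by positivity) h3)
    suffices hηe : Even η by
      rw [hη, pow_succ]
      exact mul_dvd_mul_left _ (even_iff_two_dvd.1 hηe)
    -- If `s_2 = m_2`, minimality excludes `m_2 = n_2 r_2`, and both `δ` and the `s`-term are even.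
    -- If `s_2 = m_2 / 2`, the side condition forces `m_2 = n_2 r_2`; then `l` is even, and the two
    -- odd terms `u * v * δ` and `s' * k₀ * f` cancel in parity.
    rcases hσ with hσ | ⟨hσ, hq2⟩
    · by_cases heq : ν + 1 = ρ + (κ' + 1)
      · exfalso
        rw [heq] at hm hσ
        rw [hσ] at hs
        exact h.lt_of_index_le hρ (by omega) h1 h2 hm hmq hn hn' hs
      · have hδ2 := hδe (by omega)
        rw [show σ - ν = 1 by omega] at key
        have := Int.not_even_iff_odd.2 hu2
        simpa [Int.even_sub, Int.even_mul, hδ2, this] using key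
    · have heq : ν + 1 = ρ + (κ' + 1) := by omega
      have hδ2 := Int.not_even_iff_odd.2 (hδo heq)
      have hk₀o : Odd k₀ := by
        rw [← Nat.not_even_iff_odd, even_iff_two_dvd]
        intro h3
        have := Nat.dvd_gcd hq2 h3
        rw [hk₀q] at this
        omega
      have hl : Even l := by
        rw [heq] at hm
        rw [hσ, show ν = ρ + (κ' + 1) - 1 by omega] at hs
        exact h.even_of_index hρ (by omega) h1 h2 hk hm hmq hn hn' hs hs' hk₀ hk₀o
      have hl' : Even (l : ℤ) := by exact_mod_cast hl
      have hk₀o' : ¬ Even (k₀ : ℤ) := by rw [Int.not_even_iff_odd]; exact_mod_cast hk₀o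
      have hs2 : ¬ Even (s' : ℤ) := by
        rw [even_iff_two_dvd]; exact_mod_cast hs'
      have hu3 := Int.not_even_iff_odd.2 hu2
      have hv3 := Int.not_even_iff_odd.2 hvo
      have hf3 := Int.not_even_iff_odd.2 hfo
      rw [show σ - ν = 0 by omega, pow_zero, mul_one] at key
      simpa [Int.even_sub, Int.even_mul, hl', hk₀o', hs2, hu3, hv3, hf3, hδ2] using key

end MetacyclicComparison

/-! ### From subgroups of units to the exponents `t` and `t'`. -/

lemma Subgroup.conjUnits_eq_zpowers {G : Type*} [Group G] [Finite G] {a b : G} {t : ℕ}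
    (h : MetacyclicGen a b t) (A : Subgroup G) (hA : A = Subgroup.zpowers a) :
    ∃ τ : (ZMod (Nat.card A))ˣ, (τ : ZMod (Nat.card A)) = t ∧
      A.conjUnits = Subgroup.zpowers τ := by
  have hcard : Nat.card A = orderOf a := by rw [hA, Nat.card_zpowers]
  have hcop : IsUnit (t : ZMod (Nat.card A)) := by
    obtain ⟨w, hw⟩ : ∃ w, b ^ (w + 1) = 1 :=
      ⟨orderOf b - 1, by rw [Nat.sub_add_cancel (orderOf_pos b), pow_orderOf_eq_one]⟩
    have h4 := h.pow_conj_zpow (w + 1) 1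
    rw [hw, one_mul, inv_one, mul_one, one_mul, eq_comm, ← mul_inv_eq_one, ← zpow_sub,
      ← orderOf_dvd_iff_zpow_eq_one, ← hcard, ← ZMod.intCast_zmod_eq_zero_iff_dvd] at h4
    push_cast at h4
    rw [sub_eq_zero, pow_succ'] at h4
    exact IsUnit.of_mul_eq_one _ h4
  have hmem : ∀ (g : G) (i : ℕ), g⁻¹ * a * g = a ^ i → ∀ x ∈ A, g⁻¹ * x * g = x ^ (i : ℤ) := by
    intro g i hg x hx
    rw [hA] at hx
    obtain ⟨j, rfl⟩ := Subgroup.mem_zpowers_iff.1 hx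
    have e : g⁻¹ * a ^ j * g = (g⁻¹ * a * g) ^ j := by
      have := conj_zpow (i := j) (a := g⁻¹) (b := a)
      rw [inv_inv] at this
      exact this.symm
    rw [e, hg, ← zpow_natCast, ← zpow_mul, ← zpow_mul, mul_comm]
  refine ⟨hcop.unit, hcop.unit_spec, le_antisymm ?_ ?_⟩
  · rintro u ⟨g, i, hi, hg⟩
    obtain ⟨l, k, hlk⟩ := h.span g⁻¹
    have h1 := h.conj_eq hlk
    rw [inv_inv, hg a (hA ▸ Subgroup.mem_zpowers a), ← zpow_natCast, ← mul_inv_eq_one, ← zpow_sub,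
      ← orderOf_dvd_iff_zpow_eq_one, ← hcard, ← ZMod.intCast_zmod_eq_zero_iff_dvd] at h1
    push_cast at h1
    rw [hi, sub_eq_zero] at h1
    refine Subgroup.mem_zpowers_iff.2 ⟨k, ?_⟩
    rw [zpow_natCast, ← Units.val_inj, Units.val_pow_eq_pow_val, hcop.unit_spec, h1]
  · rw [Subgroup.zpowers_le]
    refine ⟨b⁻¹, t, by push_cast; rw [hcop.unit_spec], hmem b⁻¹ t ?_⟩
    rw [inv_inv]; exact h.conj

namespace MetacyclicFactorization

lemma exists_gen {G : Type*} [Group G] [Finite G] (F : MetacyclicFactorization G) :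
    ∃ (a b : G) (t : ℕ), F.A = Subgroup.zpowers a ∧ F.B = Subgroup.zpowers b ∧
      MetacyclicGen a b t := by
  obtain ⟨a, ha⟩ := (Subgroup.isCyclic_iff_exists_zpowers_eq_top F.A).1 F.cyclic_left
  obtain ⟨b, hb⟩ := (Subgroup.isCyclic_iff_exists_zpowers_eq_top F.B).1 F.cyclic_right
  have h1 : b * a * b⁻¹ ∈ Subgroup.zpowers a := by
    rw [ha]; exact F.normal.conj_mem a (ha ▸ Subgroup.mem_zpowers a) b
  obtain ⟨t, ht⟩ := mem_powers_iff_mem_zpowers.2 h1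
  refine ⟨a, b, t, ha.symm, hb.symm, ht.symm, fun g => ?_⟩
  obtain ⟨x, hx, y, hy, rfl⟩ := F.mul_eq g
  rw [← ha] at hx
  rw [← hb] at hy
  obtain ⟨i, rfl⟩ := mem_powers_iff_mem_zpowers.2 hx
  obtain ⟨j, rfl⟩ := mem_powers_iff_mem_zpowers.2 hy
  exact ⟨i, j, rfl⟩

end MetacyclicFactorization

namespace Metacyclic

lemma invEps_eq_one_iff {m : ℕ} (hm : m ≠ 0) {τ : (ZMod m)ˣ} {t : ℕ} (ht : (τ : ZMod m) = t) :
    invEps (Subgroup.zpowers τ) = 1 ↔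
      ((part 2 (invR (Subgroup.zpowers τ)) : ℕ) : ℤ) ∣ (t : ℤ) - 1 := by
  rw [← res_eq_bot_iff ht ((part_dvd 2 _).trans (invR_dvd hm _)), invEps]
  split_ifs with h
  · simp [h]
  · simpa using h

lemma invEps_eq {m : ℕ} (T : Subgroup (ZMod m)ˣ) : invEps T = 1 ∨ invEps T = -1 := by
  unfold invEps
  split_ifs
  · exact Or.inr rfl
  · exact Or.inl rfl

lemma nuPart_dvd {m r : ℕ} (hm : m ≠ 0) : piPart (nuSet m r) m ∣ m := by
  have h1 : piPart (nuSet m r) m ∣ piPart m.primeFactors m :=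
    Finset.prod_dvd_prod_of_subset _ _ _ Finset.sdiff_subset
  exact h1.trans (Nat.prod_factorization_pow_eq_self hm).dvd

lemma not_dvd_of_dvd_nuPart {m r q : ℕ} (hr : r ≠ 0) (hq : q.Prime)
    (h : q ∣ piPart (nuSet m r) m) : ¬ q ∣ r := by
  obtain ⟨p, hp, hqp⟩ := (Prime.dvd_finsetProd_iff hq.prime _).1 h
  have hp' := Finset.mem_sdiff.1 hp
  have hpp := Nat.prime_of_mem_primeFactors hp'.1
  obtain rfl := (Nat.prime_dvd_prime_iff_eq hq hpp).1 (hq.dvd_of_dvd_pow hqp)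
  exact fun h' => hp'.2 (Nat.mem_primeFactors.2 ⟨hq, h', hr⟩)

lemma invO_dvd {m : ℕ} (hm : m ≠ 0) {τ : (ZMod m)ˣ} {t V : ℕ} (ht : (τ : ZMod m) = t)
    (hV : ((piPart (nuSet m (invR (Subgroup.zpowers τ))) m : ℕ) : ℤ) ∣ (t : ℤ) ^ V - 1) :
    invO (Subgroup.zpowers τ) ∣ V := by
  rw [invO_eq hm, res_zpowers (nuPart_dvd hm)]
  apply card_hallCompl_zpowers_dvd
  rw [units_eq_one_iff (t := t ^ V)]
  · exact_mod_cast hV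
  · rw [Units.val_pow_eq_pow_val, unitsMap_val_eq ht]; push_cast; rfl

/-- `N` is the order of `t` modulo `m_ν`: since `p` is not in `ν`, it divides this order only if it
divides `o`. -/
lemma exists_odd_pow {m : ℕ} (hm : m ≠ 0) {τ : (ZMod m)ˣ} {t p : ℕ} (ht : (τ : ZMod m) = t)
    (hp : p.Prime) (hpr : p ∣ invR (Subgroup.zpowers τ)) (hpo : ¬ p ∣ invO (Subgroup.zpowers τ)) :
    ∃ N : ℕ, ¬ p ∣ N ∧
      ((piPart (nuSet m (invR (Subgroup.zpowers τ))) m : ℕ) : ℤ) ∣ (t : ℤ) ^ N - 1 := by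
  have hr : invR (Subgroup.zpowers τ) ≠ 0 := ne_zero_of_dvd_ne_zero hm (invR_dvd hm _)
  have hQ := nuPart_dvd (r := invR (Subgroup.zpowers τ)) hm
  have : NeZero (piPart (nuSet m (invR (Subgroup.zpowers τ))) m) :=
    ⟨ne_zero_of_dvd_ne_zero hm hQ⟩
  refine ⟨orderOf (ZMod.unitsMap hQ τ), fun h => hpo ?_, ?_⟩
  · rw [invO_eq hm, res_zpowers hQ]
    refine prime_dvd_card_hallCompl hp (fun q hq => ?_) (fun h' => ?_) h
    · exact Nat.prime_of_mem_primeFactors (Finset.mem_sdiff.1 hq).1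
    · exact (Finset.mem_sdiff.1 h').2 (Nat.mem_primeFactors.2 ⟨hp, hpr, hr⟩)
  · have h1 := pow_orderOf_eq_one (ZMod.unitsMap hQ τ)
    rw [units_eq_one_iff (t := t ^ orderOf (ZMod.unitsMap hQ τ))] at h1
    · exact_mod_cast h1
    · rw [Units.val_pow_eq_pow_val, unitsMap_val_eq ht]; push_cast; rfl

lemma mem_zpowers_of_dvd {q : ℕ} {σ σ' : (ZMod q)ˣ} {t t' k : ℕ} (ht : (σ : ZMod q) = t)
    (ht' : (σ' : ZMod q) = t') (h : (q : ℤ) ∣ (t : ℤ) ^ k - t') : σ' ∈ Subgroup.zpowers σ := by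
  refine Subgroup.mem_zpowers_iff.2 ⟨k, ?_⟩
  rw [← ZMod.intCast_zmod_eq_zero_iff_dvd] at h
  push_cast at h
  rw [sub_eq_zero] at h
  rw [zpow_natCast, ← Units.val_inj, Units.val_pow_eq_pow_val, ht, ht', h]

lemma zpowers_eq_of_dvd {q : ℕ} {σ σ' : (ZMod q)ˣ} {t t' k k' : ℕ} (ht : (σ : ZMod q) = t)
    (ht' : (σ' : ZMod q) = t') (h : (q : ℤ) ∣ (t : ℤ) ^ k - t')
    (h' : (q : ℤ) ∣ (t' : ℤ) ^ k' - t) : Subgroup.zpowers σ = Subgroup.zpowers σ' :=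
  le_antisymm ((Subgroup.zpowers_le).2 (mem_zpowers_of_dvd ht' ht h'))
    ((Subgroup.zpowers_le).2 (mem_zpowers_of_dvd ht ht' h))

lemma sigma_zpowers_eq {q q' : ℕ} (hq : q = q') {σ : (ZMod q)ˣ} {σ' : (ZMod q')ˣ} {t t' k k' : ℕ}
    (ht : (σ : ZMod q) = t) (ht' : (σ' : ZMod q') = t') (h : (q : ℤ) ∣ (t : ℤ) ^ k - t')
    (h' : (q' : ℤ) ∣ (t' : ℤ) ^ k' - t) :
    (⟨q, Subgroup.zpowers σ⟩ : Σ i : ℕ, Subgroup (ZMod i)ˣ) = ⟨q', Subgroup.zpowers σ'⟩ := by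
  subst hq
  rw [zpowers_eq_of_dvd ht ht' h h']

lemma invO_congr {m m' : ℕ} (hmm : m = m') (hm : m ≠ 0) {τ : (ZMod m)ˣ} {τ' : (ZMod m')ˣ}
    {t t' k k' : ℕ} (ht : (τ : ZMod m) = t) (ht' : (τ' : ZMod m') = t')
    (hr : invR (Subgroup.zpowers τ) = invR (Subgroup.zpowers τ'))
    (h : ((piPart (nuSet m (invR (Subgroup.zpowers τ))) m : ℕ) : ℤ) ∣ (t : ℤ) ^ k - t')
    (h' : ((piPart (nuSet m (invR (Subgroup.zpowers τ))) m : ℕ) : ℤ) ∣ (t' : ℤ) ^ k' - t) :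
    invO (Subgroup.zpowers τ) = invO (Subgroup.zpowers τ') := by
  subst hmm
  rw [invO_eq hm, invO_eq hm, ← hr, res_zpowers (nuPart_dvd hm), res_zpowers (nuPart_dvd hm),
    zpowers_eq_of_dvd (unitsMap_val_eq ht _) (unitsMap_val_eq ht' _) h h']

lemma mPrime_congr {m m' : ℕ} (hmm : m = m') {T : Subgroup (ZMod m)ˣ} {T' : Subgroup (ZMod m')ˣ}
    (hr : invR T = invR T') (ho : invO T = invO T') (hε : invEps T = invEps T') (n s : ℕ) :
    mPrime T n s = mPrime T' n s := by
  unfold mPrime mPrimeAt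
  rw [hr, ho, hε, hmm]

end Metacyclic

/-! ### The congruence modulo the whole of `m'`. -/

open Metacyclic

namespace MetacyclicComparison

variable {G : Type*} [Group G] [Finite G] {a b c d : G} {m t t' l k Q : ℕ} {τ : (ZMod m)ˣ}

lemma mPrimeAt_dvd_of_trivial
    (h : MetacyclicComparison a b c d t t' l k (invR (Subgroup.zpowers τ))
      (invO (Subgroup.zpowers τ)) Q)
    (hm : orderOf a = m) {p : ℕ} (hp : p.Prime)
    (hpr : p ∣ invR (Subgroup.zpowers τ)) (hε : invEps (Subgroup.zpowers τ) ^ (p - 1) = 1)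
    (htr : ((part p (invR (Subgroup.zpowers τ)) : ℕ) : ℤ) ∣ (t : ℤ) - 1)
    (htr' : ((part p (invR (Subgroup.zpowers τ)) : ℕ) : ℤ) ∣ (t' : ℤ) - 1) :
    ((mPrimeAt (Subgroup.zpowers τ) (Subgroup.zpowers a).index (Subgroup.zpowers b).index p : ℕ) : ℤ)
      ∣ (t : ℤ) ^ k - t' := by
  have hm0 : m ≠ 0 := hm ▸ (orderOf_pos a).ne'
  have hr0 : invR (Subgroup.zpowers τ) ≠ 0 := ne_zero_of_dvd_ne_zero hm0 (invR_dvd hm0 _)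
  have hn0 : (Subgroup.zpowers a).index ≠ 0 := Subgroup.index_ne_zero_of_finite
  obtain ⟨g, hgle, hg⟩ := (Nat.dvd_prime_pow hp).1 (mPrimeAt_dvd hm0 (Subgroup.zpowers τ)
    (Subgroup.zpowers a).index (Subgroup.zpowers b).index p hp)
  rw [hg]
  have hle : ∀ i j : ℕ, p ^ i ≤ p ^ j → i ≤ j := fun i j =>
    (Nat.pow_le_pow_iff_right hp.one_lt).1
  rw [mPrimeAt] at hg
  simp only [hε, if_true] at hg
  unfold part at hg htr htr'
  set ρ := (invR (Subgroup.zpowers τ)).factorization p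
  set ω := (invO (Subgroup.zpowers τ)).factorization p
  set σ := (Subgroup.zpowers b).index.factorization p
  set κ := (Subgroup.zpowers a).index.factorization p
  push_cast at htr htr' ⊢
  -- Reads `p ^ g ≤ m'_p` as inequalities between exponents; clearing the denominator `n_p` disposes
  -- of the truncated quotient.
  have h1 := hg.symm.le
  rw [le_min_iff, le_min_iff, le_max_iff, le_max_iff, ← pow_add, ← pow_add, ← pow_add,
    Nat.le_div_iff_mul_le (pow_pos hp.pos _), ← pow_add] at h1
  obtain ⟨-, h2, h3⟩ := h1
  refine h.pow_dvd_sub_of_trivial hp hpr (μ := m.factorization p) (mq := m / p ^ m.factorization p)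
    (κ := κ) (n' := (Subgroup.zpowers a).index / p ^ κ) (σ := σ) (ρ := ρ) (ω := ω) ?_ ?_ ?_ ?_ ?_
    ?_ ?_ htr htr' hgle ?_ ?_
  · rw [hm]; exact (Nat.ordProj_mul_ordCompl_eq_self m p).symm
  · exact Nat.not_dvd_ordCompl hp hm0
  · exact (Nat.ordProj_mul_ordCompl_eq_self _ p).symm
  · exact Nat.not_dvd_ordCompl hp hn0
  · exact Nat.ordProj_dvd _ _
  · exact fun i hi => (hp.pow_dvd_iff_le_factorization hr0).1 hi
  · exact Nat.ordProj_dvd _ _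
  · exact hle _ _ h2
  · exact h3.imp (hle _ _) (Or.imp (hle _ _) (hle _ _))

/-- Either `m'_2 = r_2`, where `t` and `t'` are both `-1` and any odd exponent works, or `o` is even
and `k` itself, then odd, works. The split records how freely the exponent may be changed at `2`. -/
lemma exists_two_pow (h : MetacyclicComparison a b c d t t' l k (invR (Subgroup.zpowers τ))
      (invO (Subgroup.zpowers τ)) Q)
    (hm : orderOf a = m) (hτ : (τ : ZMod m) = t)
    (hadm' : IsAdmissible m t' (invR (Subgroup.zpowers τ)))
    (hε : invEps (Subgroup.zpowers τ) ≠ 1)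
    (hε' : ¬ ((part 2 (invR (Subgroup.zpowers τ)) : ℕ) : ℤ) ∣ (t' : ℤ) - 1) :
    (∀ i, Odd i → (mPrimeAt (Subgroup.zpowers τ) (Subgroup.zpowers a).index
        (Subgroup.zpowers b).index 2 : ℤ) ∣ (t : ℤ) ^ i - t') ∨
      2 ∣ invO (Subgroup.zpowers τ) ∧ (mPrimeAt (Subgroup.zpowers τ) (Subgroup.zpowers a).index
        (Subgroup.zpowers b).index 2 : ℤ) ∣ (t : ℤ) ^ k - t' := by
  have hm0 : m ≠ 0 := hm ▸ (orderOf_pos a).ne'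
  have : NeZero m := ⟨hm0⟩
  have hr0 : invR (Subgroup.zpowers τ) ≠ 0 := ne_zero_of_dvd_ne_zero hm0 (invR_dvd hm0 _)
  have hn0 : (Subgroup.zpowers a).index ≠ 0 := Subgroup.index_ne_zero_of_finite
  have hs0 : (Subgroup.zpowers b).index ≠ 0 := Subgroup.index_ne_zero_of_finite
  have hadm := invR_isAdmissible hm0 hτ
  rw [Ne, invEps_eq_one_iff hm0 hτ] at hε
  have hle : ∀ i j : ℕ, 2 ^ i ≤ 2 ^ j → i ≤ j := fun i j =>
    (Nat.pow_le_pow_iff_right (by norm_num)).1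
  have hlt : ∀ i j : ℕ, 2 ^ i < 2 ^ j ↔ i < j := fun i j =>
    (Nat.pow_lt_pow_iff_right (by norm_num))
  have hne : ¬ invEps (Subgroup.zpowers τ) ^ (2 - 1) = 1 := by
    rw [← invEps_eq_one_iff hm0 hτ] at hε
    simpa using hε
  have hρr := part_dvd 2 (invR (Subgroup.zpowers τ))
  have h1 := (hadm.2.2 _ hρr).resolve_left (by unfold part at hε; push_cast at hε; exact hε)
  have h1' := (hadm'.2.2 _ hρr).resolve_left (by unfold part at hε'; push_cast at hε'; exact hε')
  rw [mPrimeAt]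
  simp only [hne, if_false]
  unfold part at *
  set ρ := (invR (Subgroup.zpowers τ)).factorization 2
  set ω := (invO (Subgroup.zpowers τ)).factorization 2
  set σ := (Subgroup.zpowers b).index.factorization 2
  set κ := (Subgroup.zpowers a).index.factorization 2
  set μ := m.factorization 2
  push_cast at hε
  -- Modulo `1` or `2` the classes of `1` and `-1` coincide, so `ε = -1` needs `4 ∣ r`.
  have hρ : 2 ≤ ρ := by
    by_contra hlt
    interval_cases ρ
    · simp at hε
    · simp only [pow_one] at hε h1
      omega
  have h4t : (4 : ℤ) ∣ (t : ℤ) + 1 := (pow_dvd_pow (2 : ℤ) hρ).trans h1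
  split_ifs with hA hB
  · left
    intro i hi
    push_cast
    have h2 : (2 : ℤ) ^ ρ ∣ (t : ℤ) ^ i + 1 :=
      h1.trans (by simpa using hi.add_dvd_pow_add_pow (t : ℤ) 1)
    have h3 := dvd_sub h2 h1'
    rwa [add_sub_add_right_eq_sub] at h3
  · right
    push Not at hA
    have hω : 0 < ω := by
      by_contra h0
      have : ω = 0 := by omega
      rw [this] at hA
      simp at hA
    refine ⟨(dvd_pow_self 2 hω.ne').trans (Nat.ordProj_dvd _ 2), ?_⟩
    have hμ : 0 < μ := by
      have h5 : 2 ^ ρ < 2 ^ μ := by omega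
      have := (hlt _ _).1 h5
      omega
    obtain ⟨μ', hμ'⟩ : ∃ μ', μ = μ' + 1 := ⟨μ - 1, by omega⟩
    rw [hμ', pow_succ, Nat.mul_div_cancel _ two_pos]
    push_cast
    refine h.two_pow_dvd_sub ?_ h4t
    rw [hm, ← hμ']
    exact Nat.ordProj_dvd _ _
  · right
    push Not at hA
    have hω : 2 ≤ ω := by
      by_contra h0
      have : 2 ^ ω ≤ 2 ^ 1 := Nat.pow_le_pow_right two_pos (by omega)
      omega
    refine ⟨(dvd_pow_self 2 (by omega)).trans (Nat.ordProj_dvd _ 2), ?_⟩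
    have hμρ : ρ + 1 < μ := by
      rw [← hlt, pow_succ, mul_comm]
      exact hA.2
    push_cast
    have hμm : 2 ^ μ ≤ m := Nat.le_of_dvd (Nat.pos_of_ne_zero hm0) (Nat.ordProj_dvd _ _)
    have h4r : 4 * 2 ^ ρ ≤ m := by
      have : 2 ^ (ρ + 2) ≤ 2 ^ μ := Nat.pow_le_pow_right two_pos (by omega)
      rw [pow_add] at this
      omega
    have h4o : 4 ≤ 2 ^ ω := by
      have : 2 ^ 2 ≤ 2 ^ ω := Nat.pow_le_pow_right two_pos hω
      omega
    refine h.two_pow_dvd_sub_of_neg (μ := μ) (mq := m / 2 ^ μ) (κ := κ)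
      (n' := (Subgroup.zpowers a).index / 2 ^ κ) (σ := σ)
      (s' := (Subgroup.zpowers b).index / 2 ^ σ) (ρ := ρ) (ω := ω)
      ((dvd_pow_self 2 (by omega)).trans hρr) ?_ ?_ ?_ ?_ ?_ ?_ ?_ hρ h1 h1'
      (Nat.ordProj_dvd _ _) hω (by omega) ?_
    · rw [hm]; exact (Nat.ordProj_mul_ordCompl_eq_self m 2).symm
    · exact Nat.not_dvd_ordCompl Nat.prime_two hm0
    · exact (Nat.ordProj_mul_ordCompl_eq_self _ 2).symm
    · exact Nat.not_dvd_ordCompl Nat.prime_two hn0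
    · exact (Nat.ordProj_mul_ordCompl_eq_self _ 2).symm
    · exact Nat.not_dvd_ordCompl Nat.prime_two hs0
    · exact fun i hi => (Nat.prime_two.pow_dvd_iff_le_factorization hr0).1 hi
    · intro hωκ
      by_contra hcon
      apply hB
      refine ⟨h4o, (hlt _ _).2 hωκ, h4r, fun hsp => ?_⟩
      rw [← pow_add] at hsp ⊢
      have hsp' := hle _ _ hsp
      have hcon' : σ + 1 = μ ∧ μ < κ + ρ := by tauto
      rw [← hcon'.1, pow_succ, mul_comm]
      refine ⟨rfl, ?_⟩
      rw [← pow_succ, hlt]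
      omega

lemma exists_pow_dvd (h : MetacyclicComparison a b c d t t' l k (invR (Subgroup.zpowers τ))
      (invO (Subgroup.zpowers τ)) (piPart (nuSet m (invR (Subgroup.zpowers τ))) m))
    (hm : orderOf a = m) (hτ : (τ : ZMod m) = t)
    (hadm' : IsAdmissible m t' (invR (Subgroup.zpowers τ)))
    (hε : ((part 2 (invR (Subgroup.zpowers τ)) : ℕ) : ℤ) ∣ (t' : ℤ) - 1 ↔
      ((part 2 (invR (Subgroup.zpowers τ)) : ℕ) : ℤ) ∣ (t : ℤ) - 1) :
    ∃ i : ℕ, (mPrime (Subgroup.zpowers τ) (Subgroup.zpowers a).index (Subgroup.zpowers b).index : ℤ)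
      ∣ (t : ℤ) ^ i - t' := by
  have hm0 : m ≠ 0 := hm ▸ (orderOf_pos a).ne'
  have hr0 : invR (Subgroup.zpowers τ) ≠ 0 := ne_zero_of_dvd_ne_zero hm0 (invR_dvd hm0 _)
  have hadm := invR_isAdmissible hm0 hτ
  -- `m_ν` and the `m'_p` are pairwise coprime, but a single exponent must serve all of them.
  suffices hmain : ∃ i : ℕ,
      ((piPart (nuSet m (invR (Subgroup.zpowers τ))) m : ℕ) : ℤ) ∣ (t : ℤ) ^ i - t' ∧
      ∀ p : ℕ, p.Prime → p ∣ invR (Subgroup.zpowers τ) →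
        (mPrimeAt (Subgroup.zpowers τ) (Subgroup.zpowers a).index
          (Subgroup.zpowers b).index p : ℤ) ∣ (t : ℤ) ^ i - t' by
    obtain ⟨i, hQ, hi⟩ := hmain
    refine ⟨i, ?_⟩
    rw [Int.natCast_dvd] at hQ ⊢
    have hdiv := fun p (hp : p.Prime) => mPrimeAt_dvd hm0 (Subgroup.zpowers τ)
      (Subgroup.zpowers a).index (Subgroup.zpowers b).index p hp
    refine Nat.Coprime.mul_dvd_of_dvd_of_dvd ?_ hQ ?_
    · refine Nat.Coprime.prod_right fun p hp => ?_
      have hpp := Nat.prime_of_mem_primeFactors hp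
      refine Nat.Coprime.coprime_dvd_right (hdiv p hpp) (Nat.Coprime.pow_right _ ?_)
      rw [Nat.coprime_comm, Nat.Prime.coprime_iff_not_dvd hpp]
      exact fun h' => not_dvd_of_dvd_nuPart hr0 hpp h' (Nat.dvd_of_mem_primeFactors hp)
    · refine Finset.prod_dvd_of_isRelPrime (fun p hp q hq hpq => ?_) fun p hp => ?_
      · have hpp := Nat.prime_of_mem_primeFactors hp
        have hqp := Nat.prime_of_mem_primeFactors hq
        refine Nat.coprime_iff_isRelPrime.1 ?_
        exact Nat.Coprime.coprime_dvd_left (hdiv p hpp) (Nat.Coprime.coprime_dvd_right (hdiv q hqp)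
          (Nat.coprime_pow_primes _ _ hpp hqp hpq))
      · rw [← Int.natCast_dvd]
        exact hi p (Nat.prime_of_mem_primeFactors hp) (Nat.dvd_of_mem_primeFactors hp)
  have hodd : ∀ p : ℕ, p.Prime → p ≠ 2 → p ∣ invR (Subgroup.zpowers τ) →
      (mPrimeAt (Subgroup.zpowers τ) (Subgroup.zpowers a).index
        (Subgroup.zpowers b).index p : ℤ) ∣ (t : ℤ) ^ k - t' := by
    intro p hp hp2 hpr
    have hpo := hp.odd_of_ne_two hp2
    refine h.mPrimeAt_dvd_of_trivial hm hp hpr ?_ (hadm.2.1 _ hpo.pow (part_dvd _ _))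
      (hadm'.2.1 _ hpo.pow (part_dvd _ _))
    rcases invEps_eq (Subgroup.zpowers τ) with h1 | h1
    · rw [h1, one_pow]
    · rw [h1, (hp.even_sub_one hp2).neg_one_pow]
  by_cases hε1 : invEps (Subgroup.zpowers τ) = 1
  · refine ⟨k, h.Q_dvd_sub, fun p hp hpr => ?_⟩
    by_cases hp2 : p = 2
    · subst hp2
      have h2 := (invEps_eq_one_iff hm0 hτ).1 hε1
      exact h.mPrimeAt_dvd_of_trivial hm hp hpr (by rw [hε1, one_pow]) h2 (hε.2 h2)
    · exact hodd p hp hp2 hpr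
  · have hε2 := hε1
    rw [invEps_eq_one_iff hm0 hτ] at hε2
    have htwo := h.exists_two_pow hm hτ hadm' hε1 (mt hε.1 hε2)
    by_cases ho : 2 ∣ invO (Subgroup.zpowers τ)
    · have hk := h.odd_of_even_o ho
      refine ⟨k, h.Q_dvd_sub, fun p hp hpr => ?_⟩
      by_cases hp2 : p = 2
      · subst hp2
        exact htwo.elim (fun h' => h' k hk) And.right
      · exact hodd p hp hp2 hpr
    · have htwo' := htwo.resolve_right fun h' => ho h'.1
      have h2r : 2 ∣ invR (Subgroup.zpowers τ) := by
        by_contra h2r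
        apply hε2
        rw [part, Nat.factorization_eq_zero_of_not_dvd h2r]
        simp
      obtain ⟨N, hN, hNQ⟩ := exists_odd_pow hm0 hτ Nat.prime_two h2r ho
      by_cases hk : Odd k
      · refine ⟨k, h.Q_dvd_sub, fun p hp hpr => ?_⟩
        by_cases hp2 : p = 2
        · subst hp2
          exact htwo' k hk
        · exact hodd p hp hp2 hpr
      -- For even `k`, add the odd number `N * (m / m_2)`. The factor `N` preserves `t ^ k` modulo
      -- `m_ν`; the factor `m / m_2` preserves it modulo every odd `m'_p`, as `t ≡ 1` modulo `p`.
      · have hmo : ¬ 2 ∣ m / part 2 m := Nat.not_dvd_ordCompl Nat.prime_two hm0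
        have hshift : ∀ x : ℤ, x ∣ (t : ℤ) ^ k - t' → x ∣ (t : ℤ) ^ (N * (m / part 2 m)) - 1 →
            x ∣ (t : ℤ) ^ (k + N * (m / part 2 m)) - t' := by
          intro x h1 h2
          have h3 := dvd_add h1 (h2.mul_left ((t : ℤ) ^ k))
          refine h3.trans (dvd_of_eq ?_)
          rw [pow_add]; ring
        refine ⟨k + N * (m / part 2 m), hshift _ h.Q_dvd_sub ?_, fun p hp hpr => ?_⟩
        · rw [pow_mul]
          exact hNQ.trans (sub_one_dvd_pow_sub_one _ _)
        · by_cases hp2 : p = 2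
          · subst hp2
            apply htwo'
            refine Even.add_odd (Nat.not_odd_iff_even.1 hk) (Odd.mul ?_ ?_) <;>
              rwa [← Nat.not_even_iff_odd, even_iff_two_dvd]
          · refine hshift _ (hodd p hp hp2 hpr) ?_
            refine (Int.natCast_dvd_natCast.2 (mPrimeAt_dvd hm0 (Subgroup.zpowers τ)
              (Subgroup.zpowers a).index (Subgroup.zpowers b).index p hp)).trans ?_
            have hpo := hp.odd_of_ne_two hp2
            have h1 : (p : ℤ) ^ 1 ∣ (t : ℤ) - 1 := by
              rw [pow_one]; exact hadm.2.1 p hpo hpr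
            have h2 : p ^ m.factorization p ∣ N * (m / part 2 m) := by
              refine Dvd.dvd.mul_left ?_ N
              refine ((Nat.coprime_pow_primes (m.factorization p) (m.factorization 2) hp
                Nat.prime_two hp2)).dvd_of_dvd_mul_left ?_
              have : 2 ^ m.factorization 2 * (m / part 2 m) = m :=
                Nat.ordProj_mul_ordCompl_eq_self m 2
              rw [this]
              exact Nat.ordProj_dvd _ _
            have h3 := Int.pow_dvd_pow_sub_one one_ne_zero h1 h2
            unfold part at *
            push_cast
            exact (pow_dvd_pow (p : ℤ) (by omega)).trans h3

end MetacyclicComparison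

lemma Metacyclic.IsAdmissible.congr {m m' t r r' : ℕ} (h : IsAdmissible m t r) (hm : m = m')
    (hr : r = r') : IsAdmissible m' t r' := by
  subst hm hr
  exact h

/-! ### Minimal factorizations and the conclusion. -/

namespace MetacyclicFactorization

variable {G : Type*} [Group G]

lemma key_eq_iff (F F' : MetacyclicFactorization G) : F.key = F'.key ↔
    Nat.card F.A = Nat.card F'.A ∧ F.r = F'.r ∧ F.B.index = F'.B.index := by
  simp only [key, toLex_inj, Prod.mk.injEq]

lemma IsMinimal.key_eq {F F' : MetacyclicFactorization G} (h : F.IsMinimal) (h' : F'.IsMinimal) :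
    F.key = F'.key :=
  le_antisymm (h F') (h' F)

/-- With the same `A` the first two entries of the key agree, so minimality reduces to the last one.
-/
lemma IsMinimal.index_le {F : MetacyclicFactorization G} (h : F.IsMinimal)
    {F' : MetacyclicFactorization G} (hA : F'.A = F.A) : F.B.index ≤ F'.B.index := by
  have h1 := h F'
  have hr : F'.r = F.r := by unfold r; rw [hA]
  simpa [key, hA, hr, Prod.Lex.toLex_le_toLex] using h1

lemma IsMinimal.exists_comparison [Finite G] {F F' : MetacyclicFactorization G} (h : F.IsMinimal)
    (h' : F'.IsMinimal) {a b c d : G} {t t' : ℕ} (hA : F.A = Subgroup.zpowers a)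
    (hB : F.B = Subgroup.zpowers b) (hC : F'.A = Subgroup.zpowers c)
    (hD : F'.B = Subgroup.zpowers d) (hab : MetacyclicGen a b t) (hcd : MetacyclicGen c d t')
    {τ : (ZMod (Nat.card F.A))ˣ} (hτ : (τ : ZMod (Nat.card F.A)) = t) :
    ∃ l k : ℕ, MetacyclicComparison a b c d t t' l k (invR (Subgroup.zpowers τ))
      (invO (Subgroup.zpowers τ))
      (piPart (nuSet (Nat.card F.A) (invR (Subgroup.zpowers τ))) (Nat.card F.A)) := by
  obtain ⟨h1, h2, h3⟩ := (key_eq_iff F F').1 (h.key_eq h')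
  have hm0 : Nat.card F.A ≠ 0 := Nat.card_pos.ne'
  have hr0 : invR (Subgroup.zpowers τ) ≠ 0 := ne_zero_of_dvd_ne_zero hm0 (invR_dvd hm0 _)
  have hm : orderOf a = Nat.card F.A := by rw [hA, Nat.card_zpowers]
  have hm' : orderOf c = Nat.card F'.A := by rw [hC, Nat.card_zpowers]
  obtain ⟨l, k, hd⟩ := hab.span d
  refine ⟨l, k, hab, hcd, hd, by rw [hm, hm', h1], ?_, by rw [← hB, ← hD, h3],
    by rw [hm]; exact invR_dvd hm0 _,
    fun p i hp hpm hpt => prime_pow_dvd_invR hm0 hτ hp (by rwa [hm] at hpm) hpt,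
    fun i hi hit => two_pow_dvd_invR hm0 hτ (by rwa [hm] at hi) hit,
    by rw [hm]; exact nuPart_dvd hm0,
    fun q hq hqQ => not_dvd_of_dvd_nuPart hr0 hq hqQ, fun V hV => invO_dvd hm0 hτ hV,
    fun b' hb' => ?_⟩
  · have e1 := F.A.card_mul_index
    have e2 := F'.A.card_mul_index
    rw [← e1, h1] at e2
    rw [← hA, ← hC]
    exact Nat.eq_of_mul_eq_mul_left Nat.card_pos e2
  · rw [← hB]
    refine h.index_le (F' := ⟨F.A, Subgroup.zpowers b', F.normal, F.cyclic_left,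
      inferInstance, fun g => ?_⟩) rfl
    obtain ⟨i, j, rfl⟩ := hb'.span g
    exact ⟨a ^ i, hA ▸ Subgroup.pow_mem _ (Subgroup.mem_zpowers a) i, b' ^ j,
      Subgroup.pow_mem _ (Subgroup.mem_zpowers b') j, rfl⟩

lemma IsMinimal.delta_eq [Finite G] {F F' : MetacyclicFactorization G} (h : F.IsMinimal)
    (h' : F'.IsMinimal) : F.delta = F'.delta := by
  obtain ⟨a, b, t, hA, hB, hab⟩ := F.exists_gen
  obtain ⟨c, d, t', hC, hD, hcd⟩ := F'.exists_gen
  obtain ⟨τ, hτ, hT⟩ := Subgroup.conjUnits_eq_zpowers hab F.A hA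
  obtain ⟨τ', hτ', hT'⟩ := Subgroup.conjUnits_eq_zpowers hcd F'.A hC
  obtain ⟨l, k, hcmp⟩ := h.exists_comparison h' hA hB hC hD hab hcd hτ
  obtain ⟨l', k', hcmp'⟩ := h'.exists_comparison h hC hD hA hB hcd hab hτ'
  obtain ⟨hcard, hr, hs⟩ := (key_eq_iff F F').1 (h.key_eq h')
  unfold r at hr
  rw [hT, hT'] at hr
  have hm0 : Nat.card F.A ≠ 0 := Nat.card_pos.ne'
  have hm0' : Nat.card F'.A ≠ 0 := Nat.card_pos.ne'
  have hm : orderOf a = Nat.card F.A := by rw [hA, Nat.card_zpowers]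
  have hm' : orderOf c = Nat.card F'.A := by rw [hC, Nat.card_zpowers]
  have hadm := invR_isAdmissible hm0 hτ
  have hadm' := invR_isAdmissible hm0' hτ'
  have hn : F.A.index = F'.A.index := by rw [hA, hC, hcmp.index_left]
  have hr2 : part 2 (invR (Subgroup.zpowers τ)) ∣ orderOf a :=
    by rw [hm]; exact (part_dvd 2 _).trans (invR_dvd hm0 _)
  have hε : ((part 2 (invR (Subgroup.zpowers τ)) : ℕ) : ℤ) ∣ (t' : ℤ) - 1 ↔
      ((part 2 (invR (Subgroup.zpowers τ)) : ℕ) : ℤ) ∣ (t : ℤ) - 1 :=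
    ⟨hab.dvd_of_dvd_sub_one hcd hcmp.order_eq.symm hr2,
      hcd.dvd_of_dvd_sub_one hab hcmp.order_eq (by rw [hcmp.order_eq]; exact hr2)⟩
  have hQ' := hcmp'.Q_dvd_sub
  rw [← hr, ← hcard] at hQ'
  have ho := invO_congr hcard hm0 hτ hτ' hr hcmp.Q_dvd_sub hQ'
  have he : invEps (Subgroup.zpowers τ) = invEps (Subgroup.zpowers τ') := by
    have h1 := invEps_eq_one_iff hm0 hτ
    have h2 := invEps_eq_one_iff hm0' hτ'
    rw [← hr, hε] at h2
    have h3 := h1.trans h2.symm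
    rcases invEps_eq (Subgroup.zpowers τ) with h4 | h4
    · rw [h4, h3.1 h4]
    · rcases invEps_eq (Subgroup.zpowers τ') with h5 | h5
      · rw [h5, h3.2 h5]
      · rw [h4, h5]
  have hmod : F.modulus = F'.modulus := by
    unfold modulus
    rw [hT, hT', hn, hs]
    exact mPrime_congr hcard hr ho he _ _
  obtain ⟨i, hi⟩ := hcmp.exists_pow_dvd hm hτ
    (hadm'.congr hcard.symm hr.symm) hε
  obtain ⟨i', hi'⟩ := hcmp'.exists_pow_dvd hm' hτ'
    (hadm.congr hcard hr) (by rw [← hr]; exact hε.symm)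
  rw [← hA, ← hB, ← hT] at hi
  rw [← hC, ← hD, ← hT'] at hi'
  unfold delta
  have e1 : F.A.conjUnits.map (ZMod.unitsMap F.modulus_dvd)
      = Subgroup.zpowers (ZMod.unitsMap F.modulus_dvd τ) := by rw [hT, MonoidHom.map_zpowers]
  have e2 : F'.A.conjUnits.map (ZMod.unitsMap F'.modulus_dvd)
      = Subgroup.zpowers (ZMod.unitsMap F'.modulus_dvd τ') := by rw [hT', MonoidHom.map_zpowers]
  rw [e1, e2]
  exact sigma_zpowers_eq hmod (unitsMap_val_eq hτ _) (unitsMap_val_eq hτ' _) hi hi'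

lemma exists_isMinimal (F₀ : MetacyclicFactorization G) :
    ∃ F : MetacyclicFactorization G, F.IsMinimal := by
  obtain ⟨_, ⟨F, rfl⟩, hF⟩ := WellFounded.has_min (wellFounded_lt (α := ℕ ×ₗ ℕ ×ₗ ℕ))
    (Set.range (key (G := G))) ⟨_, F₀, rfl⟩
  exact ⟨F, fun F' => not_lt.1 (hF _ ⟨F', rfl⟩)⟩

end MetacyclicFactorization

lemma IsMetacyclic.nonempty_factorization {G : Type*} [Group G] (h : IsMetacyclic G) :
    Nonempty (MetacyclicFactorization G) := by
  obtain ⟨A, hA, hc, hq⟩ := h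
  obtain ⟨x, hx⟩ := hq.exists_generator
  obtain ⟨b, rfl⟩ := QuotientGroup.mk_surjective x
  refine ⟨⟨A, Subgroup.zpowers b, hA, hc, inferInstance, fun g => ?_⟩⟩
  obtain ⟨j, hj⟩ := Subgroup.mem_zpowers_iff.1 (hx g)
  refine ⟨g * (b ^ j)⁻¹, ?_, b ^ j, Subgroup.zpow_mem _ (Subgroup.mem_zpowers b) j, by group⟩
  rw [← QuotientGroup.eq_one_iff]
  simp only [QuotientGroup.mk_mul, QuotientGroup.mk_inv, QuotientGroup.mk_zpow]
  rw [hj, mul_inv_cancel]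

theorem mainTheorem6 {G : Type*} [Group G] [Finite G] :
    (∀ F F' : MetacyclicFactorization G, F.IsMinimal → F'.IsMinimal → F.delta = F'.delta) ∧
    (IsMetacyclic G → ∃! δ : (Σ k : ℕ, Subgroup (ZMod k)ˣ),
      ∃ F : MetacyclicFactorization G, F.IsMinimal ∧ F.delta = δ) := by
  refine ⟨fun F F' h h' => h.delta_eq h', fun hG => ?_⟩
  obtain ⟨F₀⟩ := hG.nonempty_factorization
  obtain ⟨F, hF⟩ := F₀.exists_isMinimal
  refine ⟨F.delta, ⟨F, hF, rfl⟩, ?_⟩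
  rintro _ ⟨F', hF', rfl⟩
  exact hF'.delta_eq hF
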